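/- Let $k\ge 1$ and $\Sigma=\{\sigma_1,\dots,\sigma_k\}$. Consider the regular expressions generated by $\beta := \varepsilon \mid \sigma\in\Sigma \mid (\beta+\beta)\mid(\beta\cdot\beta)\mid(\beta^\star)$; the size of an expression is its number of symbols, parentheses not counted. Let $\mathcal R_k$ be the set of those expressions in which $\Sigma^\star$ does not occur in a union, i.e. no subexpression $(\beta_1+\beta_2)$ has an operand $\beta_1$ or $\beta_2$ of the form $(\sigma_{i_1}+\cdots+\sigma_{i_k})^\star$ (with any parenthesisation of the sum) where $\sigma_{i_1},\dots,\sigma_{i_k}$ is a permutation of $\Sigma$. Let $\ell_n$ be the total number of occurrences of letters in all expressions of $\mathcal R_k$ of size $n$, and $L_k(z)=\sum_n \ell_n z^n$. Put $$C_k=(k-1)!\binom{2k-2}{k-1},\qquad h_k(z)=1-z-C_kz^{2k+1},$$ $$\Delta_k(z)=1-2z-(7+8k)z^2+4z^{2k+1}C_kh_k(z),\qquad g_k(z)=2-C_kz^{2k-1}\bigl(h_k(z)-C_kz^{2k+1}\bigr).$$ Then $\Delta_k$ has exactly one zero $\eta_k$ in the open interval $\bigl(0,\tfrac1{\sqrt{8k+8}}\bigr)$;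 write $\Delta_k(z)=\bigl(1-\tfrac z{\eta_k}\bigr)\psi_k(z)$ with $\psi_k\in\mathbb R[z]$. One has $\psi_k(\eta_k)>0$; for every real $z$ with $|z|<\eta_k$ one has $\Delta_k(z)>0$, the series $L_k(z)$ converges, and $$L_k(z)=\frac{k z^{2k}C_k}{2}+\frac{k z\,g_k(z)}{2\sqrt{\Delta_k(z)}};$$ and, as $n\to\infty$, $$[z^n]L_k(z)=\ell_n\sim\frac{k\,\eta_k\,g_k(\eta_k)}{2\sqrt\pi\,\sqrt{\psi_k(\eta_k)}}\;n^{-1/2}\,\eta_k^{-n}.$$ -/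

import Mathlib

open Polynomial

namespace RENoSigmaStar

/-- The standard regular expressions: those built from `ε`, letters, `+`, `·` and `⋆`
(the empty-set symbol is not used). -/
def IsStandard {A : Type*} : RegularExpression A → Prop
  | .zero => False
  | .epsilon => True
  | .char _ => True
  | .plus e f => IsStandard e ∧ IsStandard f
  | .comp e f => IsStandard e ∧ IsStandard f
  | .star e => IsStandard e

/-- The tree-size: the number of symbols, disregarding parentheses. -/
def size {A : Type*} : RegularExpression A → ℕ
  | .zero => 1
  | .epsilon => 1
  | .char _ => 1
  | .plus e f => size e + size f + 1
  | .comp e f => size e + size f + 1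
  | .star e => size e + 1

/-- The alphabetic size: the number of occurrences of letters. -/
def letters {A : Type*} : RegularExpression A → ℕ
  | .zero => 0
  | .epsilon => 0
  | .char _ => 1
  | .plus e f => letters e + letters f
  | .comp e f => letters e + letters f
  | .star e => letters e

/-- `IsSumOf e l`: the expression `e` is `σ₁ + ⋯ + σₘ`, parenthesised in some way, where
`l = [σ₁, …, σₘ]` is its list of summands, from left to right, all of them letters. -/
inductive IsSumOf {A : Type*} : RegularExpression A → List A → Prop
  | char (a : A) : IsSumOf (.char a) [a]
  | plus {e f : RegularExpression A} {l m : List A} :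
      IsSumOf e l → IsSumOf f m → IsSumOf (.plus e f) (l ++ m)

/-- The absorbing pattern `Σ⋆`: the expressions `(σ₁ + ⋯ + σₖ)⋆` (with any parenthesisation)
where `σ₁, …, σₖ` is a permutation of the alphabet. -/
def IsSigmaStar {A : Type*} (e : RegularExpression A) : Prop :=
  ∃ (f : RegularExpression A) (l : List A),
    e = .star f ∧ IsSumOf f l ∧ l.Nodup ∧ ∀ a : A, a ∈ l

/-- No union `f + g` occurring in the expression has the pattern `Σ⋆` as one of its operands. -/
def AvoidsSigmaStar {A : Type*} : RegularExpression A → Prop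
  | .zero => True
  | .epsilon => True
  | .char _ => True
  | .plus e f => AvoidsSigmaStar e ∧ AvoidsSigmaStar f ∧ ¬ IsSigmaStar e ∧ ¬ IsSigmaStar f
  | .comp e f => AvoidsSigmaStar e ∧ AvoidsSigmaStar f
  | .star e => AvoidsSigmaStar e

/-- The set of regular expressions over the `k`-letter alphabet in which `Σ⋆` does not occur
in a union. -/
def expressions (k : ℕ) : Set (RegularExpression (Fin k)) :=
  {e | IsStandard e ∧ AvoidsSigmaStar e}

/-- The expressions of size `n` in this set. -/
def expressionsOfSize (k n : ℕ) : Set (RegularExpression (Fin k)) :=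
  {e | e ∈ expressions k ∧ size e = n}

theorem finite_size_le (A : Type*) [Finite A] (n : ℕ) :
    {e : RegularExpression A | size e ≤ n}.Finite := by
  induction n with
  | zero =>
    refine Set.Finite.subset Set.finite_empty ?_
    rintro e he
    cases e <;> simp [size] at he
  | succ n ih =>
    refine Set.Finite.subset
      ((((Set.finite_singleton RegularExpression.zero).union
        (Set.finite_singleton RegularExpression.epsilon)).union
        (Set.finite_range (RegularExpression.char (α := A)))).union
        (((ih.image2 RegularExpression.plus ih).union
        (ih.image2 RegularExpression.comp ih)).union (ih.image RegularExpression.star))) ?_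
    rintro e he
    rw [Set.mem_ofPred_eq] at he
    cases e with
    | zero => exact .inl (.inl (.inl rfl))
    | epsilon => exact .inl (.inl (.inr rfl))
    | char a => exact .inl (.inr ⟨a, rfl⟩)
    | plus e f =>
      rw [size] at he
      exact .inr (.inl (.inl ⟨e, by simp only [Set.mem_ofPred_eq]; omega,
        f, by simp only [Set.mem_ofPred_eq]; omega, rfl⟩))
    | comp e f =>
      rw [size] at he
      exact .inr (.inl (.inr ⟨e, by simp only [Set.mem_ofPred_eq]; omega,
        f, by simp only [Set.mem_ofPred_eq]; omega, rfl⟩))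
    | star e =>
      rw [size] at he
      exact .inr (.inr ⟨e, by simp only [Set.mem_ofPred_eq]; omega, rfl⟩)

theorem finite_expressionsOfSize (k n : ℕ) : (expressionsOfSize k n).Finite :=
  (finite_size_le (Fin k) n).subset fun _ he => he.2.le

/-- The total number of letters in all expressions of size `n`, that is, the coefficient
`[zⁿ] L_k(z)`. -/
noncomputable def totalLetters (k n : ℕ) : ℕ :=
  ∑ e ∈ (finite_expressionsOfSize k n).toFinset, letters e

/-- `C_k = (k-1)! * binom (2k-2) (k-1)`, for `k ≥ 1`. -/
def patternCount (k : ℕ) : ℕ :=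
  Nat.factorial (k - 1) * Nat.choose (2 * k - 2) (k - 1)

/-- `p_k(z) = 1 - 2z - (7+8k)z²`. -/
noncomputable def pPoly (k : ℕ) : ℝ[X] :=
  1 - 2 * X - C (7 + 8 * (k : ℝ)) * X ^ 2

/-- `h_k(z) = 1 - z - C_k z^{2k+1}`. -/
noncomputable def hPoly (k : ℕ) : ℝ[X] :=
  1 - X - C (patternCount k : ℝ) * X ^ (2 * k + 1)

/-- `Δ_k(z) = p_k(z) + 4 z^{2k+1} C_k h_k(z)`. -/
noncomputable def deltaPoly (k : ℕ) : ℝ[X] :=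
  pPoly k + 4 * X ^ (2 * k + 1) * C (patternCount k : ℝ) * hPoly k

/-- `g_k(z) = 2 - C_k z^{2k-1} (h_k(z) - C_k z^{2k+1})`, for `k ≥ 1`. -/
noncomputable def gPoly (k : ℕ) : ℝ[X] :=
  2 - C (patternCount k : ℝ) * X ^ (2 * k - 1) *
    (hPoly k - C (patternCount k : ℝ) * X ^ (2 * k + 1))

/-- `η` is the unique zero of `Δ_k` in the open interval from `0` to `1 / √(8k+8)`. -/
def IsEta (k : ℕ) (η : ℝ) : Prop :=
  (η ∈ Set.Ioo 0 (1 / √(8 * (k : ℝ) + 8)) ∧ (deltaPoly k).eval η = 0) ∧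
    ∀ x ∈ Set.Ioo 0 (1 / √(8 * (k : ℝ) + 8)), (deltaPoly k).eval x = 0 → x = η

end RENoSigmaStar

namespace RENoSigmaStar

/-! Let R be the generating function of the expressions and P = C_k z^{2k} that of the pattern.
Sorting by the root symbol gives R = z(1 + k + (R - P)² + R² + R), since only a union forbids the
pattern as an operand. Marking letters by a second variable and differentiating at 1 gives a linear
equation for L. Completing the square, S = 1 - z + 2zP - 4zR satisfies S² = Δ. The coefficient of L
in its equation is again S, so 2L = kP + kzg/S, and everything reduces to 1/√Δ.

The main point is that η is the only zero of Δ in the closed disc |z| ≤ η, and is simple. On the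
real interval C_k x^{2k} is so small that Δ' < 0. For complex z, Δ is a square minus 8z² times a
polynomial with nonnegative coefficients. Passing from |z| to z does not increase the modulus of the
second part, and strictly increases that of the squared part unless z = |z|
(`eq_of_aeval_deltaPoly_eq_zero`).

Hence Δ = (1 - z/η)ψ with ψ free of zeros in that disc. Splitting ψ into linear factors over ℂ shows
that ψ^{-1/2} is a power series converging absolutely beyond η (`exists_invSqrt`). The coefficients
of (1 - z/η)^{-1/2} are explicit central binomial numbers, whose asymptotics follow from Wallis'
product. Dominated convergence applied to the Cauchy product transfers them to L
(`tendsto_coeff_invSqrt_mul`), and g(η) > 0 keeps the limiting constant nonzero. -/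

/-! ### Counting the pattern -/

/-- The binary tree of the unions at the top of an expression. -/
def unionTree {A : Type*} : RegularExpression A → BinaryTree Unit
  | .plus e f => .node () (unionTree e) (unionTree f)
  | _ => .nil

/-- The letters at the top of the unions, from left to right. -/
def unionLeaves {A : Type*} : RegularExpression A → List A
  | .plus e f => unionLeaves e ++ unionLeaves f
  | .char a => [a]
  | _ => []

variable {A : Type*}

theorem plus_inj {e f e' f' : RegularExpression A} :
    RegularExpression.plus e f = .plus e' f' ↔ e = e' ∧ f = f' :=
  ⟨fun h => by cases h; exact ⟨rfl, rfl⟩, fun h => by rw [h.1, h.2]⟩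

theorem comp_inj {e f e' f' : RegularExpression A} :
    RegularExpression.comp e f = .comp e' f' ↔ e = e' ∧ f = f' :=
  ⟨fun h => by cases h; exact ⟨rfl, rfl⟩, fun h => by rw [h.1, h.2]⟩

theorem star_inj {e e' : RegularExpression A} :
    RegularExpression.star e = .star e' ↔ e = e' :=
  ⟨fun h => by cases h; rfl, fun h => by rw [h]⟩

theorem char_inj {a b : A} : RegularExpression.char a = .char b ↔ a = b :=
  ⟨fun h => by cases h; rfl, fun h => by rw [h]⟩

theorem IsSumOf.unionLeaves_eq {e : RegularExpression A} {l : List A} (h : IsSumOf e l) :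
    unionLeaves e = l := by
  induction h with
  | char a => rfl
  | plus _ _ ihe ihf => simp [unionLeaves, ihe, ihf]

theorem IsSumOf.numNodes_unionTree {e : RegularExpression A} {l : List A} (h : IsSumOf e l) :
    (unionTree e).numNodes + 1 = l.length := by
  induction h with
  | char a => rfl
  | plus _ _ ihe ihf => simp [unionTree, ← ihe, ← ihf]; ring

theorem IsSumOf.letters_eq {e : RegularExpression A} {l : List A} (h : IsSumOf e l) :
    letters e = l.length := by
  induction h with
  | char a => rfl
  | plus _ _ ihe ihf => simp [letters, ihe, ihf]

theorem IsSumOf.size_add_one {e : RegularExpression A} {l : List A} (h : IsSumOf e l) :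
    size e + 1 = 2 * l.length := by
  induction h with
  | char a => rfl
  | plus _ _ ihe ihf => simp only [size, List.length_append]; omega

theorem IsSumOf.isStandard {e : RegularExpression A} {l : List A} (h : IsSumOf e l) :
    IsStandard e := by
  induction h with
  | char a => trivial
  | plus _ _ ihe ihf => exact ⟨ihe, ihf⟩

theorem IsSumOf.not_isSigmaStar {e : RegularExpression A} {l : List A} (h : IsSumOf e l) :
    ¬ IsSigmaStar e := by
  rintro ⟨f, m, rfl, -⟩
  cases h

theorem IsSumOf.avoidsSigmaStar {e : RegularExpression A} {l : List A} (h : IsSumOf e l) :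
    AvoidsSigmaStar e := by
  induction h with
  | char a => trivial
  | plus he hf ihe ihf => exact ⟨ihe, ihf, he.not_isSigmaStar, hf.not_isSigmaStar⟩

/-- The shape of the left subtree fixes its number of leaves, hence the place where the list of
summands is cut. -/
theorem IsSumOf.eq_of_unionTree_eq {e f : RegularExpression A} {l : List A}
    (he : IsSumOf e l) (hf : IsSumOf f l) (h : unionTree e = unionTree f) : e = f := by
  induction he generalizing f with
  | char a =>
    generalize hl : [a] = l at hf
    cases hf with
    | char b => rw [List.singleton_inj.1 hl]
    | plus h1 h2 => simp [unionTree] at h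
  | @plus e₁ e₂ l₁ l₂ he₁ he₂ ih₁ ih₂ =>
    generalize hl : l₁ ++ l₂ = l at hf
    cases hf with
    | char => simp [unionTree] at h
    | @plus f₁ f₂ m₁ m₂ hf₁ hf₂ =>
      simp only [unionTree, BinaryTree.node.injEq, true_and] at h
      have hlen : l₁.length = m₁.length := by
        rw [← he₁.numNodes_unionTree, ← hf₁.numNodes_unionTree, h.1]
      obtain ⟨rfl, rfl⟩ := List.append_inj hl hlen
      rw [ih₁ hf₁ h.1, ih₂ hf₂ h.2]

theorem exists_isSumOf (t : BinaryTree Unit) (l : List A) (h : t.numNodes + 1 = l.length) :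
    ∃ e, IsSumOf e l ∧ unionTree e = t := by
  induction t generalizing l with
  | nil =>
    obtain ⟨a, rfl⟩ := List.length_eq_one_iff.1 h.symm
    exact ⟨.char a, .char a, rfl⟩
  | node u t₁ t₂ ih₁ ih₂ =>
    simp only [BinaryTree.numNodes] at h
    obtain ⟨e₁, he₁, rfl⟩ := ih₁ (l.take (t₁.numNodes + 1)) (by rw [List.length_take]; omega)
    obtain ⟨e₂, he₂, rfl⟩ := ih₂ (l.drop ((unionTree e₁).numNodes + 1))
      (by rw [List.length_drop]; omega)
    refine ⟨.plus e₁ e₂, ?_, rfl⟩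
    simpa using he₁.plus he₂

theorem nodup_and_forall_mem_iff {k : ℕ} (l : List (Fin k)) :
    (l.Nodup ∧ ∀ a, a ∈ l) ↔ l ∈ (List.finRange k).permutations := by
  rw [List.mem_permutations]
  constructor
  · rintro ⟨h, h'⟩
    exact (List.perm_ext_iff_of_nodup h (List.nodup_finRange k)).2 fun a => by simp [h']
  · intro h
    exact ⟨h.nodup_iff.2 (List.nodup_finRange k), fun a => h.mem_iff.2 (List.mem_finRange a)⟩

/-- A full sum amounts to an independent choice of the order of the letters and of the
parenthesisation, which yields the count k! · Catalan(k - 1). -/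
theorem bijOn_unionLeaves_unionTree {k : ℕ} (hk : 1 ≤ k) :
    Set.BijOn (fun e : RegularExpression (Fin k) => (unionLeaves e, unionTree e))
      {e | ∃ l, IsSumOf e l ∧ l.Nodup ∧ ∀ a, a ∈ l}
      ((List.finRange k).permutations.toFinset ×ˢ BinaryTree.treesOfNumNodesEq (k - 1) :
        Finset (List (Fin k) × BinaryTree Unit)) := by
  have hlen {l : List (Fin k)} (h : l ∈ (List.finRange k).permutations) : l.length = k := by
    simpa using (List.mem_permutations.1 h).length_eq
  refine ⟨?_, ?_, ?_⟩
  · rintro e ⟨l, hl, h⟩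
    rw [nodup_and_forall_mem_iff] at h
    have h1 := hl.numNodes_unionTree
    rw [hlen h] at h1
    simp only [Finset.mem_coe, Finset.mem_product, List.mem_toFinset,
      BinaryTree.mem_treesOfNumNodesEq, hl.unionLeaves_eq]
    exact ⟨h, by omega⟩
  · rintro e ⟨l, hl, -⟩ f ⟨m, hm, -⟩ h
    simp only [Prod.mk.injEq, hl.unionLeaves_eq, hm.unionLeaves_eq] at h
    obtain ⟨rfl, h⟩ := h
    exact hl.eq_of_unionTree_eq hm h
  · rintro ⟨l, t⟩ h
    simp only [Finset.mem_coe, Finset.mem_product, List.mem_toFinset,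
      BinaryTree.mem_treesOfNumNodesEq] at h
    obtain ⟨e, he, rfl⟩ := exists_isSumOf t l (by rw [hlen h.1]; omega)
    exact ⟨e, ⟨l, he, (nodup_and_forall_mem_iff l).2 h.1⟩, by simp [he.unionLeaves_eq]⟩

theorem factorial_mul_catalan_eq_patternCount {k : ℕ} (hk : 1 ≤ k) :
    k.factorial * catalan (k - 1) = patternCount k := by
  obtain ⟨n, rfl⟩ := Nat.exists_eq_add_of_le' hk
  have h := succ_mul_catalan_eq_centralBinom n
  have h2 : 2 * (n + 1) - 2 = 2 * n := by omega
  rw [patternCount, Nat.add_sub_cancel, Nat.factorial_succ, h2,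
    ← Nat.centralBinom_eq_two_mul_choose, ← h]
  ring

theorem ncard_isSigmaStar {k : ℕ} (hk : 1 ≤ k) :
    {e : RegularExpression (Fin k) | IsSigmaStar e}.ncard = patternCount k := by
  have h1 : {e : RegularExpression (Fin k) | IsSigmaStar e} =
      RegularExpression.star '' {e | ∃ l, IsSumOf e l ∧ l.Nodup ∧ ∀ a, a ∈ l} := by
    ext e
    constructor
    · rintro ⟨f, l, rfl, h⟩
      exact ⟨f, ⟨l, h⟩, rfl⟩
    · rintro ⟨f, ⟨l, h⟩, rfl⟩
      exact ⟨f, l, rfl, h⟩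
  have hb := bijOn_unionLeaves_unionTree hk
  rw [h1, Set.ncard_image_of_injective _ (fun a b h => star_inj.1 h),
    ← hb.injOn.ncard_image, hb.image_eq, Set.ncard_coe_finset, Finset.card_product,
    List.toFinset_card_of_nodup (List.nodup_permutations _ (List.nodup_finRange k)),
    List.length_permutations, List.length_finRange, BinaryTree.treesOfNumNodesEq_card_eq_catalan,
    factorial_mul_catalan_eq_patternCount hk]

theorem length_eq_of_nodup_and_forall_mem {k : ℕ} {l : List (Fin k)} (h : l.Nodup ∧ ∀ a, a ∈ l) :
    l.length = k := by
  rw [nodup_and_forall_mem_iff, List.mem_permutations] at h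
  simpa using h.length_eq

theorem IsSigmaStar.size_eq {k : ℕ} {e : RegularExpression (Fin k)} (h : IsSigmaStar e) :
    size e = 2 * k := by
  obtain ⟨f, l, rfl, hf, h⟩ := h
  rw [size, hf.size_add_one, length_eq_of_nodup_and_forall_mem h]

theorem IsSigmaStar.letters_eq {k : ℕ} {e : RegularExpression (Fin k)} (h : IsSigmaStar e) :
    letters e = k := by
  obtain ⟨f, l, rfl, hf, h⟩ := h
  rw [letters, hf.letters_eq, length_eq_of_nodup_and_forall_mem h]

theorem IsSigmaStar.mem_expressions {k : ℕ} {e : RegularExpression (Fin k)} (h : IsSigmaStar e) :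
    e ∈ expressions k := by
  obtain ⟨f, l, rfl, hf, h⟩ := h
  exact ⟨hf.isStandard, hf.avoidsSigmaStar⟩

/-! ### The enumerating polynomials -/

/-- The expressions of size `n` avoiding the pattern in unions, as a finset. -/
noncomputable def expressionFinset (k n : ℕ) : Finset (RegularExpression (Fin k)) :=
  (finite_expressionsOfSize k n).toFinset

theorem mem_expressionFinset {k n : ℕ} {e : RegularExpression (Fin k)} :
    e ∈ expressionFinset k n ↔ (IsStandard e ∧ AvoidsSigmaStar e) ∧ size e = n := by
  rw [expressionFinset, Set.Finite.mem_toFinset]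
  rfl

/-- The expressions of size `n`, enumerated by their number of letters. -/
noncomputable def letterPoly (k n : ℕ) : ℝ[X] :=
  ∑ e ∈ expressionFinset k n, X ^ letters e

/-- The instances of the pattern of size `n`, enumerated by their number of letters. -/
noncomputable def patternPoly (k n : ℕ) : ℝ[X] :=
  if n = 2 * k then C (patternCount k : ℝ) * X ^ k else 0

open Classical in
theorem sum_filter_isSigmaStar {k : ℕ} (hk : 1 ≤ k) (n : ℕ) :
    ∑ e ∈ expressionFinset k n with IsSigmaStar e, (X : ℝ[X]) ^ letters e = patternPoly k n := by
  rw [Finset.sum_congr rfl (g := fun _ => (X : ℝ[X]) ^ k)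
    fun e he => by rw [(Finset.mem_filter.1 he).2.letters_eq], Finset.sum_const, patternPoly]
  split_ifs with h
  · have : ((expressionFinset k n).filter IsSigmaStar : Set (RegularExpression (Fin k))) =
        {e | IsSigmaStar e} := by
      ext e
      simp only [Finset.coe_filter, Set.mem_ofPred_eq, mem_expressionFinset]
      exact ⟨fun he => he.2, fun he => ⟨⟨he.mem_expressions, he.size_eq.trans h.symm⟩, he⟩⟩
    rw [← Set.ncard_coe_finset, this, ncard_isSigmaStar hk]
    simp
  · rw [Finset.filter_false_of_mem, Finset.card_empty, zero_smul]
    rintro e he hs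
    exact h ((mem_expressionFinset.1 he).2.symm.trans hs.size_eq)

open Classical in
theorem sum_filter_not_isSigmaStar {k : ℕ} (hk : 1 ≤ k) (n : ℕ) :
    ∑ e ∈ expressionFinset k n with ¬ IsSigmaStar e, (X : ℝ[X]) ^ letters e =
      letterPoly k n - patternPoly k n := by
  rw [← sum_filter_isSigmaStar hk, letterPoly, eq_sub_iff_add_eq, add_comm,
    Finset.sum_filter_add_sum_filter_not]

theorem sum_sigma_antidiagonal {B : Type*} [DecidableEq B] {R : Type*} [CommSemiring R]
    (T : ℕ → Finset B) (w : B → R) (n : ℕ) :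
    ∑ x ∈ (Finset.HasAntidiagonal.antidiagonal n).sigma fun p => T p.1 ×ˢ T p.2, w x.2.1 * w x.2.2 =
      ∑ p ∈ Finset.HasAntidiagonal.antidiagonal n, (∑ e ∈ T p.1, w e) * ∑ e ∈ T p.2, w e := by
  rw [Finset.sum_sigma]
  refine Finset.sum_congr rfl fun p _ => ?_
  rw [Finset.sum_product, Finset.sum_mul_sum]

theorem size_pos (e : RegularExpression A) : 0 < size e := by
  cases e <;> simp [size]

theorem letterPoly_zero (k : ℕ) : letterPoly k 0 = 0 := by
  rw [letterPoly, Finset.sum_eq_zero]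
  intro e he
  exact absurd (mem_expressionFinset.1 he).2 (size_pos e).ne'

-- Classification by the root symbol. Subtracting `patternPoly` is legitimate because every instance
-- of the pattern itself belongs to the set being counted: the sum under its star contains no
-- starred operand.
open Classical in
theorem letterPoly_succ {k : ℕ} (hk : 1 ≤ k) (n : ℕ) :
    letterPoly k (n + 1) = (if n = 0 then 1 + (k : ℝ[X]) * X else 0) +
      ∑ p ∈ Finset.HasAntidiagonal.antidiagonal n,
        (letterPoly k p.1 - patternPoly k p.1) * (letterPoly k p.2 - patternPoly k p.2) +
      ∑ p ∈ Finset.HasAntidiagonal.antidiagonal n, letterPoly k p.1 * letterPoly k p.2 + letterPoly k n := by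
  let S := expressionFinset k
  -- `T` holds the admissible operands of a union; `I₀`, …, `I₃` collect atoms, unions,
  -- concatenations and stars.
  let T : ℕ → Finset (RegularExpression (Fin k)) := fun n => (S n).filter fun e => ¬ IsSigmaStar e
  let I₀ : Finset (RegularExpression (Fin k)) :=
    if n = 0 then insert .epsilon (Finset.univ.image .char) else ∅
  let I₁ := ((Finset.HasAntidiagonal.antidiagonal n).sigma fun p => T p.1 ×ˢ T p.2).image
    fun x => RegularExpression.plus x.2.1 x.2.2
  let I₂ := ((Finset.HasAntidiagonal.antidiagonal n).sigma fun p => S p.1 ×ˢ S p.2).image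
    fun x => RegularExpression.comp x.2.1 x.2.2
  let I₃ := (S n).image RegularExpression.star
  have hI : expressionFinset k (n + 1) = I₀ ∪ I₁ ∪ I₂ ∪ I₃ := by
    ext e
    have h0 : e ∈ I₀ ↔ n = 0 ∧ (e = .epsilon ∨ ∃ a, .char a = e) := by
      by_cases h : n = 0 <;> simp [I₀, h]
    have h1 : e ∈ I₁ ↔ ∃ f g, f ∈ T (size f) ∧ g ∈ T (size g) ∧ size f + size g = n ∧
        .plus f g = e := by
      simp only [I₁, Finset.mem_image, Finset.mem_sigma, Finset.mem_product,
        Finset.HasAntidiagonal.mem_antidiagonal]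
      constructor
      · rintro ⟨⟨⟨i, j⟩, f, g⟩, ⟨hij, hf, hg⟩, rfl⟩
        have hf' := (mem_expressionFinset.1 (Finset.mem_filter.1 hf).1).2
        have hg' := (mem_expressionFinset.1 (Finset.mem_filter.1 hg).1).2
        dsimp only at hf hg hij hf' hg'
        subst hf' hg'
        exact ⟨f, g, hf, hg, hij, rfl⟩
      · rintro ⟨f, g, hf, hg, h, rfl⟩
        exact ⟨⟨(size f, size g), f, g⟩, ⟨h, hf, hg⟩, rfl⟩
    have h2 : e ∈ I₂ ↔ ∃ f g, f ∈ S (size f) ∧ g ∈ S (size g) ∧ size f + size g = n ∧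
        .comp f g = e := by
      simp only [I₂, Finset.mem_image, Finset.mem_sigma, Finset.mem_product,
        Finset.HasAntidiagonal.mem_antidiagonal]
      constructor
      · rintro ⟨⟨⟨i, j⟩, f, g⟩, ⟨hij, hf, hg⟩, rfl⟩
        have hf' := (mem_expressionFinset.1 hf).2
        have hg' := (mem_expressionFinset.1 hg).2
        dsimp only at hf hg hij hf' hg'
        subst hf' hg'
        exact ⟨f, g, hf, hg, hij, rfl⟩
      · rintro ⟨f, g, hf, hg, h, rfl⟩
        exact ⟨⟨(size f, size g), f, g⟩, ⟨h, hf, hg⟩, rfl⟩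
    simp only [Finset.mem_union, h0, h1, h2, I₃, Finset.mem_image, T, S, Finset.mem_filter,
      mem_expressionFinset]
    cases e <;> simp only [IsStandard, AvoidsSigmaStar, size, reduceCtorEq,
      plus_inj, comp_inj, star_inj,
      char_inj] <;> grind
  have hd₁ : Disjoint I₀ I₁ := by
    rw [Finset.disjoint_left]
    intro e h0 h1
    obtain ⟨x, -, rfl⟩ := Finset.mem_image.1 h1
    by_cases h : n = 0 <;> simp [I₀, h] at h0
  have hd₂ : Disjoint (I₀ ∪ I₁) I₂ := by
    rw [Finset.disjoint_left]
    intro e h0 h1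
    obtain ⟨x, -, rfl⟩ := Finset.mem_image.1 h1
    by_cases h : n = 0 <;> simp [I₀, I₁, h] at h0
  have hd₃ : Disjoint (I₀ ∪ I₁ ∪ I₂) I₃ := by
    rw [Finset.disjoint_left]
    intro e h0 h1
    obtain ⟨x, -, rfl⟩ := Finset.mem_image.1 h1
    by_cases h : n = 0 <;> simp [I₀, I₁, I₂, h] at h0
  have hs₀ : ∑ e ∈ I₀, (X : ℝ[X]) ^ letters e = if n = 0 then 1 + (k : ℝ[X]) * X else 0 := by
    simp only [I₀]
    split_ifs
    · rw [Finset.sum_insert (by simp), Finset.sum_image (fun a _ b _ h => char_inj.1 h)]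
      simp [letters]
    · simp
  have hs₁ : ∑ e ∈ I₁, (X : ℝ[X]) ^ letters e = ∑ p ∈ Finset.HasAntidiagonal.antidiagonal n,
      (letterPoly k p.1 - patternPoly k p.1) * (letterPoly k p.2 - patternPoly k p.2) := by
    simp only [← sum_filter_not_isSigmaStar hk]
    rw [← sum_sigma_antidiagonal T (fun e => (X : ℝ[X]) ^ letters e) n, Finset.sum_image]
    · simp [letters, pow_add]
    · rintro ⟨⟨i, j⟩, f, g⟩ hx ⟨⟨i', j'⟩, f', g'⟩ hy h
      simp only [T, S, Finset.coe_sigma, Set.mem_sigma_iff, Finset.mem_coe, Finset.mem_product,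
        Finset.mem_filter, mem_expressionFinset] at hx hy
      simp only [plus_inj] at h
      obtain ⟨rfl, rfl⟩ := h
      obtain ⟨-, ⟨⟨-, rfl⟩, -⟩, ⟨-, rfl⟩, -⟩ := hx
      obtain ⟨-, ⟨⟨-, rfl⟩, -⟩, ⟨-, rfl⟩, -⟩ := hy
      rfl
  have hs₂ : ∑ e ∈ I₂, (X : ℝ[X]) ^ letters e =
      ∑ p ∈ Finset.HasAntidiagonal.antidiagonal n, letterPoly k p.1 * letterPoly k p.2 := by
    simp only [letterPoly]
    rw [← sum_sigma_antidiagonal S (fun e => (X : ℝ[X]) ^ letters e) n, Finset.sum_image]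
    · simp [letters, pow_add]
    · rintro ⟨⟨i, j⟩, f, g⟩ hx ⟨⟨i', j'⟩, f', g'⟩ hy h
      simp only [S, Finset.coe_sigma, Set.mem_sigma_iff, Finset.mem_coe, Finset.mem_product,
        mem_expressionFinset] at hx hy
      simp only [comp_inj] at h
      obtain ⟨rfl, rfl⟩ := h
      obtain ⟨-, ⟨-, rfl⟩, -, rfl⟩ := hx
      obtain ⟨-, ⟨-, rfl⟩, -, rfl⟩ := hy
      rfl
  have hs₃ : ∑ e ∈ I₃, (X : ℝ[X]) ^ letters e = letterPoly k n := by
    rw [Finset.sum_image (fun a _ b _ h => star_inj.1 h)]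
    rfl
  rw [letterPoly, hI, Finset.sum_union hd₃, Finset.sum_union hd₂, Finset.sum_union hd₁,
    hs₀, hs₁, hs₂, hs₃]

/-! ### The generating functions -/

/-- The generating function of the expressions. -/
noncomputable def expressionSeries (k : ℕ) : PowerSeries ℝ :=
  .mk fun n => (letterPoly k n).eval 1

/-- The generating function of the occurrences of letters. -/
noncomputable def letterSeries (k : ℕ) : PowerSeries ℝ :=
  .mk fun n => (totalLetters k n : ℝ)

/-- The generating function of the pattern. -/
noncomputable def patternSeries (k : ℕ) : PowerSeries ℝ :=
  .C (patternCount k : ℝ) * .X ^ (2 * k)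

/-- The square root of `Δ`, as a formal power series. -/
noncomputable def sqrtDelta (k : ℕ) : PowerSeries ℝ :=
  1 - .X + 2 * .X * patternSeries k - 4 * .X * expressionSeries k

theorem eval_derivative_letterPoly (k n : ℕ) :
    (derivative (letterPoly k n)).eval 1 = totalLetters k n := by
  simp [letterPoly, totalLetters, derivative_X_pow, eval_finsetSum, expressionFinset]

theorem eval_patternPoly (k n : ℕ) :
    (patternPoly k n).eval 1 = PowerSeries.coeff n (patternSeries k) := by
  rw [patternPoly, patternSeries, PowerSeries.coeff_C_mul, PowerSeries.coeff_X_pow]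
  split_ifs <;> simp

theorem eval_derivative_patternPoly (k n : ℕ) :
    (derivative (patternPoly k n)).eval 1 = k * PowerSeries.coeff n (patternSeries k) := by
  rw [patternPoly, patternSeries, PowerSeries.coeff_C_mul, PowerSeries.coeff_X_pow]
  split_ifs <;> simp [derivative_X_pow, mul_comm]

theorem expressionSeries_eq {k : ℕ} (hk : 1 ≤ k) :
    expressionSeries k = .X * (1 + (k : PowerSeries ℝ) +
      (expressionSeries k - patternSeries k) * (expressionSeries k - patternSeries k) +
      expressionSeries k * expressionSeries k + expressionSeries k) := by
  ext n
  cases n with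
  | zero => simp [expressionSeries, letterPoly_zero]
  | succ n =>
    rw [PowerSeries.coeff_succ_X_mul, expressionSeries, PowerSeries.coeff_mk, letterPoly_succ hk]
    simp only [eval_add, eval_finsetSum, eval_mul, eval_sub, eval_patternPoly, map_add,
      PowerSeries.coeff_mul, map_sub, PowerSeries.coeff_mk]
    congr 3
    rw [← map_natCast (PowerSeries.C (R := ℝ)) k, PowerSeries.coeff_one, PowerSeries.coeff_C]
    split_ifs <;> simp

/-- This is the derivative at 1 of the recursion `letterPoly_succ`; each instance of the pattern has
k letters, whence the factor k. -/
theorem letterSeries_eq {k : ℕ} (hk : 1 ≤ k) :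
    letterSeries k = .X * ((k : PowerSeries ℝ) +
      2 * ((letterSeries k - (k : PowerSeries ℝ) * patternSeries k) *
        (expressionSeries k - patternSeries k)) +
      2 * (letterSeries k * expressionSeries k) + letterSeries k) := by
  have hP : (k : PowerSeries ℝ) * patternSeries k =
      .mk fun n => k * PowerSeries.coeff n (patternSeries k) := by
    ext n
    rw [← map_natCast (PowerSeries.C (R := ℝ)) k, PowerSeries.coeff_C_mul, PowerSeries.coeff_mk]
  -- The doubled products are split into the two terms that the Leibniz rule produces under the
  -- antidiagonal sum.
  have h1 : 2 * ((letterSeries k - (k : PowerSeries ℝ) * patternSeries k) *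
        (expressionSeries k - patternSeries k)) =
      (letterSeries k - (k : PowerSeries ℝ) * patternSeries k) *
        (expressionSeries k - patternSeries k) + (expressionSeries k - patternSeries k) *
        (letterSeries k - (k : PowerSeries ℝ) * patternSeries k) := by ring
  have h2 : 2 * (letterSeries k * expressionSeries k) =
      letterSeries k * expressionSeries k + expressionSeries k * letterSeries k := by ring
  rw [h1, h2, hP]
  ext n
  cases n with
  | zero => simp [letterSeries, ← eval_derivative_letterPoly, letterPoly_zero]
  | succ n =>
    rw [PowerSeries.coeff_succ_X_mul, letterSeries, PowerSeries.coeff_mk,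
      ← eval_derivative_letterPoly, letterPoly_succ hk]
    simp only [map_add, derivative_sum, derivative_mul, eval_add,
      eval_finsetSum, eval_mul, eval_sub, eval_patternPoly, eval_derivative_patternPoly,
      eval_derivative_letterPoly, PowerSeries.coeff_mul, map_sub, PowerSeries.coeff_mk,
      Finset.sum_add_distrib, expressionSeries]
    congr 3
    rw [← map_natCast (PowerSeries.C (R := ℝ)) k, PowerSeries.coeff_C]
    split_ifs <;> simp

theorem coe_deltaPoly (k : ℕ) : (deltaPoly k : PowerSeries ℝ) =
    (1 - .X + 2 * .X * patternSeries k) ^ 2 -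
      8 * .X ^ 2 * (1 + (k : PowerSeries ℝ) + patternSeries k ^ 2) := by
  have h4 : ((4 : ℝ[X]) : PowerSeries ℝ) = 4 := map_ofNat (Polynomial.coeToPowerSeries.ringHom) 4
  have h2 : ((2 : ℝ[X]) : PowerSeries ℝ) = 2 := map_ofNat (Polynomial.coeToPowerSeries.ringHom) 2
  have hc : PowerSeries.C (7 + 8 * (k : ℝ)) = 7 + 8 * (k : PowerSeries ℝ) := by
    rw [map_add, map_mul, map_natCast, map_ofNat, map_ofNat]
  simp only [deltaPoly, pPoly, hPoly, patternSeries, Polynomial.coe_add, Polynomial.coe_sub,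
    Polynomial.coe_mul, Polynomial.coe_pow, Polynomial.coe_X, Polynomial.coe_C, Polynomial.coe_one,
    h4, h2, hc]
  ring

theorem sqrtDelta_sq {k : ℕ} (hk : 1 ≤ k) : sqrtDelta k ^ 2 = deltaPoly k := by
  rw [coe_deltaPoly, sqrtDelta]
  linear_combination (-8 * PowerSeries.X) * expressionSeries_eq hk

theorem constantCoeff_sqrtDelta (k : ℕ) : PowerSeries.constantCoeff (sqrtDelta k) = 1 := by
  simp [sqrtDelta]

/-- In the linear equation for L the coefficient of L is 1 - z - 2z(R - P) - 2zR, which is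
`sqrtDelta`, so one divides by it. -/
theorem two_mul_letterSeries {k : ℕ} (hk : 1 ≤ k) :
    2 * letterSeries k = (k : PowerSeries ℝ) * patternSeries k +
      (k : PowerSeries ℝ) * .X * (gPoly k : PowerSeries ℝ) * (sqrtDelta k)⁻¹ := by
  have hS : sqrtDelta k * (sqrtDelta k)⁻¹ = 1 :=
    PowerSeries.mul_inv_cancel _ (by simp [constantCoeff_sqrtDelta])
  have h2 : ((2 : ℝ[X]) : PowerSeries ℝ) = 2 := map_ofNat (Polynomial.coeToPowerSeries.ringHom) 2
  have hX : (PowerSeries.X : PowerSeries ℝ) * .X ^ (2 * k - 1) = .X ^ (2 * k) := by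
    rw [← pow_succ']; congr 1; omega
  have hg : (.X : PowerSeries ℝ) * (gPoly k : PowerSeries ℝ) =
      2 * .X - patternSeries k * (1 - .X - 2 * .X * patternSeries k) := by
    simp only [gPoly, hPoly, patternSeries, Polynomial.coe_sub,
      Polynomial.coe_mul, Polynomial.coe_pow, Polynomial.coe_X, Polynomial.coe_C,
      Polynomial.coe_one, h2]
    linear_combination (-PowerSeries.C (patternCount k : ℝ) * (1 - PowerSeries.X -
      2 * PowerSeries.C (patternCount k : ℝ) * PowerSeries.X ^ (2 * k + 1))) * hX
  have hL : 2 * letterSeries k * sqrtDelta k =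
      (k : PowerSeries ℝ) * patternSeries k * sqrtDelta k +
        (k : PowerSeries ℝ) * (.X * (gPoly k : PowerSeries ℝ)) := by
    rw [hg, sqrtDelta]
    linear_combination 2 * letterSeries_eq hk
  linear_combination (sqrtDelta k)⁻¹ * hL +
    ((k : PowerSeries ℝ) * patternSeries k - 2 * letterSeries k) * hS

/-! ### The zeros of `Δ` -/

/-- With n = k - 1 and the bound 4^n for the central binomial coefficient, this controls C_k x^{2k}
at x² = 1/(8k+8). It fails for n = 0, so k = 1 needs separate treatment later. -/
theorem factorial_mul_four_pow_lt (n : ℕ) (hn : 1 ≤ n) :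
    n.factorial * 4 ^ n * (2 * (2 * n + 3) ^ 2) < (8 * (n + 2)) ^ (n + 1) := by
  induction n, hn using Nat.le_induction with
  | base => decide
  | succ n hn ih =>
    have h1 : 4 * (n + 1) * (2 * n + 5) ^ 2 ≤ 8 * (n + 3) * (2 * n + 3) ^ 2 := by nlinarith
    have h2 : (8 * (n + 2)) ^ (n + 1) ≤ (8 * (n + 3)) ^ (n + 1) := by gcongr; omega
    have h3 : 0 < n.factorial * 4 ^ n := by positivity
    calc (n + 1).factorial * 4 ^ (n + 1) * (2 * (2 * (n + 1) + 3) ^ 2)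
        = n.factorial * 4 ^ n * 2 * (4 * (n + 1) * (2 * n + 5) ^ 2) := by
          rw [Nat.factorial_succ]; ring
      _ ≤ n.factorial * 4 ^ n * 2 * (8 * (n + 3) * (2 * n + 3) ^ 2) := by gcongr
      _ = n.factorial * 4 ^ n * (2 * (2 * n + 3) ^ 2) * (8 * (n + 3)) := by ring
      _ < (8 * (n + 2)) ^ (n + 1) * (8 * (n + 3)) := by gcongr
      _ ≤ (8 * (n + 3)) ^ (n + 1) * (8 * (n + 3)) := by gcongr
      _ = (8 * (n + 1 + 2)) ^ (n + 1 + 1) := by ring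

theorem patternCount_succ (n : ℕ) : patternCount (n + 1) = n.factorial * n.centralBinom := by
  have h2 : 2 * (n + 1) - 2 = 2 * n := by omega
  rw [patternCount, Nat.add_sub_cancel, h2, Nat.centralBinom_eq_two_mul_choose]

/-- The squared factor is what the comparison of z^{2k+1} with |z|^{2k+1} costs. At the right
endpoint the bound is false for k = 1. -/
theorem patternCount_mul_pow_lt {k : ℕ} (hk : 2 ≤ k) {x : ℝ} (hx : 8 * (k + 1) * x ^ 2 ≤ 1) :
    2 * (2 * k + 1) ^ 2 * ((patternCount k : ℝ) * x ^ (2 * k)) < 1 := by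
  obtain ⟨n, rfl⟩ := Nat.exists_eq_add_of_le' (Nat.one_le_of_lt hk)
  have h1 : (n.factorial : ℝ) * 4 ^ n * (2 * (2 * n + 3) ^ 2) < (8 * (n + 2)) ^ (n + 1) := by
    exact_mod_cast factorial_mul_four_pow_lt n (by omega)
  have h2 : (patternCount (n + 1) : ℝ) ≤ n.factorial * 4 ^ n := by
    rw [patternCount_succ]
    exact_mod_cast Nat.mul_le_mul_left _ (Nat.centralBinom_le_four_pow n)
  push_cast at hx ⊢
  have h3 : (8 * ((n : ℝ) + 2) * x ^ 2) ^ (n + 1) ≤ 1 :=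
    pow_le_one₀ (by positivity) (by linarith)
  have h4 : (0 : ℝ) < (8 * (n + 2)) ^ (n + 1) := by positivity
  have h5 : 0 ≤ (x ^ 2) ^ (n + 1) := by positivity
  rw [mul_pow] at h3
  rw [pow_mul]
  rcases h5.eq_or_lt with h5 | h5
  · rw [← h5]; simp
  calc 2 * (2 * ((n : ℝ) + 1) + 1) ^ 2 * (patternCount (n + 1) * (x ^ 2) ^ (n + 1))
      ≤ 2 * (2 * ((n : ℝ) + 1) + 1) ^ 2 * (n.factorial * 4 ^ n * (x ^ 2) ^ (n + 1)) := by gcongr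
    _ = n.factorial * 4 ^ n * (2 * (2 * n + 3) ^ 2) * (x ^ 2) ^ (n + 1) := by ring
    _ < (8 * (n + 2)) ^ (n + 1) * (x ^ 2) ^ (n + 1) := by gcongr
    _ ≤ 1 := h3

theorem patternCount_one : patternCount 1 = 1 := by simp [patternCount]

/-- A single factor 2k + 1 suffices for the sign of Δ', and this version includes k = 1. -/
theorem patternCount_mul_pow_lt' {k : ℕ} (hk : 1 ≤ k) {x : ℝ} (hx : 8 * (k + 1) * x ^ 2 ≤ 1) :
    2 * (2 * k + 1) * ((patternCount k : ℝ) * x ^ (2 * k)) < 1 := by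
  rcases hk.eq_or_lt with rfl | hk'
  · rw [patternCount_one]
    norm_num at hx ⊢
    linarith
  · refine lt_of_le_of_lt ?_ (patternCount_mul_pow_lt hk' hx)
    have h : 0 ≤ (patternCount k : ℝ) * x ^ (2 * k) := by rw [pow_mul]; positivity
    have : (2 * k + 1 : ℝ) ≤ (2 * k + 1) ^ 2 := by nlinarith [Nat.cast_nonneg (α := ℝ) k]
    gcongr

theorem eval_deltaPoly (k : ℕ) (x : ℝ) : (deltaPoly k).eval x =
    (1 - x + 2 * patternCount k * x ^ (2 * k + 1)) ^ 2 -
      8 * x ^ 2 * (k + 1 + (patternCount k * x ^ (2 * k)) ^ 2) := by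
  simp only [deltaPoly, pPoly, hPoly, eval_add, eval_sub, eval_mul, eval_pow, eval_X, eval_C,
    eval_one, eval_ofNat]
  ring

theorem aeval_deltaPoly (k : ℕ) (z : ℂ) : aeval z (deltaPoly k) =
    (1 - z + 2 * patternCount k * z ^ (2 * k + 1)) ^ 2 -
      8 * z ^ 2 * (k + 1 + (patternCount k * z ^ (2 * k)) ^ 2) := by
  simp only [deltaPoly, pPoly, hPoly, map_add, map_sub, map_mul, map_pow, aeval_X,
    map_one, map_ofNat, map_natCast]
  ring

theorem eval_derivative_deltaPoly_neg {k : ℕ} (hk : 1 ≤ k) {x : ℝ} (hx0 : 0 ≤ x)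
    (hx : 8 * (k + 1) * x ^ 2 ≤ 1) : (derivative (deltaPoly k)).eval x < 0 := by
  have h1 := patternCount_mul_pow_lt' hk hx
  have h : (derivative (deltaPoly k)).eval x = -2 + 2 * (2 * (2 * k + 1) *
      (patternCount k * x ^ (2 * k))) - (2 * (7 + 8 * k) * x + (patternCount k * x ^ (2 * k)) *
        (4 * (2 * k + 2) * x + 4 * (4 * k + 2) * (patternCount k * x ^ (2 * k)) * x)) := by
    simp only [deltaPoly, pPoly, hPoly, derivative_add, derivative_sub, derivative_mul,
      derivative_X_pow, derivative_C, derivative_X, derivative_one, derivative_ofNat, eval_add,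
      eval_sub, eval_mul, eval_pow, eval_X, eval_C, eval_one, eval_ofNat, eval_zero,
      Nat.add_sub_cancel]
    push_cast
    ring
  have h2 : 0 ≤ 2 * (7 + 8 * k) * x + (patternCount k * x ^ (2 * k)) *
        (4 * (2 * k + 2) * x + 4 * (4 * k + 2) * (patternCount k * x ^ (2 * k)) * x) := by
    positivity
  rw [h]
  linarith

theorem mul_sq_le_one_iff (k : ℕ) {x : ℝ} (hx : 0 ≤ x) :
    8 * ((k : ℝ) + 1) * x ^ 2 ≤ 1 ↔ x ≤ 1 / √(8 * (k : ℝ) + 8) := by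
  have h : 0 < √(8 * (k : ℝ) + 8) := by positivity
  rw [le_div_iff₀ h, ← sq_le_one_iff₀ (mul_nonneg hx h.le), mul_pow, Real.sq_sqrt (by positivity)]
  ring_nf

theorem strictAntiOn_deltaPoly {k : ℕ} (hk : 1 ≤ k) :
    StrictAntiOn (fun x : ℝ => (deltaPoly k).eval x) (Set.Icc 0 (1 / √(8 * (k : ℝ) + 8))) := by
  refine strictAntiOn_of_deriv_neg (convex_Icc _ _) (deltaPoly k).continuous.continuousOn ?_
  intro x hx
  rw [interior_Icc] at hx
  rw [Polynomial.deriv]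
  exact eval_derivative_deltaPoly_neg hk hx.1.le ((mul_sq_le_one_iff k hx.1.le).2 hx.2.le)

theorem exists_eval_deltaPoly_neg {k : ℕ} (hk : 1 ≤ k) : ∃ r : ℝ, 0 < r ∧
    r ≤ 1 / √(8 * (k : ℝ) + 8) ∧ (deltaPoly k).eval r < 0 ∧
    2 * (2 * k + 1) ^ 2 * ((patternCount k : ℝ) * r ^ (2 * k)) < 1 := by
  rcases hk.eq_or_lt with rfl | hk'
  -- For k = 1 the endpoint 1/4 violates the last bound; 23/100 is small enough for it, yet already
  -- beyond the zero of Δ.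
  · refine ⟨23 / 100, by norm_num, (mul_sq_le_one_iff 1 (by norm_num)).1 (by norm_num), ?_, ?_⟩
    · rw [eval_deltaPoly, patternCount_one]
      norm_num
    · rw [patternCount_one]
      norm_num
  · have h0 : 0 < 1 / √(8 * (k : ℝ) + 8) := by positivity
    have h1 := (mul_sq_le_one_iff k h0.le).2 le_rfl
    refine ⟨_, h0, le_rfl, ?_, patternCount_mul_pow_lt hk' h1⟩
    have h2 : 8 * ((k : ℝ) + 1) * (1 / √(8 * (k : ℝ) + 8)) ^ 2 = 1 := by
      rw [div_pow, Real.sq_sqrt (by positivity)]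
      field_simp
    have h3 := patternCount_mul_pow_lt' hk h1
    generalize 1 / √(8 * (k : ℝ) + 8) = x at *
    have h4 : 0 ≤ (patternCount k : ℝ) * x ^ (2 * k) := by positivity
    have hk2 : (2 : ℝ) ≤ k := by exact_mod_cast hk'
    have hx1 : x < 1 := by nlinarith
    have h5 : (patternCount k : ℝ) * x ^ (2 * k) < 1 / 10 := by nlinarith
    have h6 : (deltaPoly k).eval x = (1 - x + 2 * x * (patternCount k * x ^ (2 * k))) ^ 2 -
        1 - 8 * (x * (patternCount k * x ^ (2 * k))) ^ 2 := by
      rw [eval_deltaPoly]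
      linear_combination -h2
    rw [h6]
    have h7 : (1 - x + 2 * x * (patternCount k * x ^ (2 * k))) ^ 2 < 1 := by
      rw [sq_lt_one_iff_abs_lt_one, abs_lt]
      constructor <;> nlinarith
    nlinarith [sq_nonneg (x * (patternCount k * x ^ (2 * k)))]

theorem exists_isEta {k : ℕ} (hk : 1 ≤ k) : ∃ η : ℝ, IsEta k η ∧
    2 * (2 * k + 1) ^ 2 * ((patternCount k : ℝ) * η ^ (2 * k)) < 1 := by
  obtain ⟨r, hr0, hr, hneg, hb⟩ := exists_eval_deltaPoly_neg hk
  have h0 : (deltaPoly k).eval 0 = 1 := by rw [eval_deltaPoly]; simp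
  obtain ⟨η, hη, hη0⟩ := intermediate_value_Ioo' hr0.le (deltaPoly k).continuous.continuousOn
    (show (0 : ℝ) ∈ Set.Ioo _ _ from ⟨hneg, by rw [h0]; norm_num⟩)
  refine ⟨η, ⟨⟨⟨hη.1, hη.2.trans_le hr⟩, hη0⟩, fun x hx hx0 => ?_⟩, lt_of_le_of_lt ?_ hb⟩
  · exact (strictAntiOn_deltaPoly hk).injOn ⟨hx.1.le, hx.2.le⟩ ⟨hη.1.le, (hη.2.trans_le hr).le⟩
      (hx0.trans hη0.symm)
  · have := hη.1.le
    have := hη.2.le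
    gcongr

/-- In polar form, 1 - cos((m+1)θ) ≤ (m+1)²(1 - cos θ). It follows from ||w| - w|² = 2|w|(|w| - Re
w) for w = z and w = z^{m+1}, since |z|^{m+1} - z^{m+1} is |z| - z times m + 1 terms of modulus
|z|^m. -/
theorem norm_pow_sub_re_pow_le (z : ℂ) (hz : z ≠ 0) (m : ℕ) :
    ‖z‖ ^ (m + 1) - (z ^ (m + 1)).re ≤ (m + 1) ^ 2 * ‖z‖ ^ m * (‖z‖ - z.re) := by
  have hr : 0 < ‖z‖ := norm_pos_iff.2 hz
  have key (w : ℂ) : ‖(‖w‖ : ℂ) - w‖ ^ 2 = 2 * ‖w‖ * (‖w‖ - w.re) := by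
    have := Complex.sq_norm w
    rw [Complex.normSq_apply] at this
    rw [Complex.sq_norm, Complex.normSq_apply]
    simp only [Complex.sub_re, Complex.ofReal_re, Complex.sub_im, Complex.ofReal_im]
    linear_combination -this
  have h1 := key z
  have h2 := key (z ^ (m + 1))
  rw [norm_pow] at h2
  have h3 : ‖(‖z‖ : ℂ) ^ (m + 1) - z ^ (m + 1)‖ ≤ (m + 1) * ‖z‖ ^ m * ‖(‖z‖ : ℂ) - z‖ := by
    rw [← (Commute.all (‖z‖ : ℂ) z).geom_sum₂_mul (m + 1), norm_mul]
    refine mul_le_mul_of_nonneg_right ?_ (norm_nonneg _)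
    refine (norm_sum_le _ _).trans ?_
    have h (i : ℕ) (hi : i ∈ Finset.range (m + 1)) :
        ‖(‖z‖ : ℂ) ^ i * z ^ (m + 1 - 1 - i)‖ = ‖z‖ ^ m := by
      rw [norm_mul, norm_pow, norm_pow, Complex.norm_real, norm_norm, ← pow_add]
      congr 1
      have := Finset.mem_range.1 hi
      omega
    rw [Finset.sum_congr rfl h]
    simp
  have h4 := pow_le_pow_left₀ (norm_nonneg _) h3 2
  rw [mul_pow, h1] at h4
  push_cast at h2
  rw [h2] at h4
  have h5 : 0 < 2 * ‖z‖ ^ (m + 1) := by positivity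
  refine le_of_mul_le_mul_left (h4.trans_eq ?_) h5
  ring

/-- Isolates the gain of modulus in the squared part of Δ. The last term is nonnegative when c ≥ 0,
and for small c|z|^m the first outweighs the second. -/
theorem sq_norm_sub_sq {c : ℝ} (z : ℂ) (m : ℕ) :
    ‖1 - z + 2 * c * z ^ (m + 1)‖ ^ 2 - (1 - ‖z‖ + 2 * c * ‖z‖ ^ (m + 1)) ^ 2 =
      2 * (‖z‖ - z.re) - 4 * c * (‖z‖ ^ (m + 1) - (z ^ (m + 1)).re) +
        4 * c * ‖z‖ ^ 2 * (‖z‖ ^ m - (z ^ m).re) := by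
  have hz := Complex.sq_norm z
  have hzm := Complex.sq_norm (z ^ m)
  rw [Complex.normSq_apply] at hz hzm
  rw [norm_pow] at hzm
  rw [Complex.sq_norm, Complex.normSq_apply]
  simp only [pow_succ z, Complex.add_re, Complex.sub_re, Complex.one_re, Complex.mul_re,
    Complex.re_ofNat, Complex.im_ofNat, Complex.ofReal_re, Complex.ofReal_im, Complex.add_im,
    Complex.sub_im, Complex.one_im, Complex.mul_im]
  generalize (z ^ m).re = a at *
  generalize (z ^ m).im = b at *
  rw [pow_succ ‖z‖]
  generalize ‖z‖ ^ m = R at *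
  generalize ‖z‖ = r at *
  linear_combination (-1 + 4 * c * a - 4 * c ^ 2 * (a * a + b * b)) * hz - 4 * c ^ 2 * r ^ 2 * hzm

theorem eq_of_aeval_deltaPoly_eq_zero {k : ℕ} (hk : 1 ≤ k) {η : ℝ} (hη : IsEta k η)
    (hb : 2 * (2 * k + 1) ^ 2 * ((patternCount k : ℝ) * η ^ (2 * k)) < 1) {z : ℂ}
    (hz : ‖z‖ ≤ η) (h : aeval z (deltaPoly k) = 0) : z = η := by
  have hz0 : z ≠ 0 := by
    rintro rfl
    rw [aeval_deltaPoly] at h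
    simp at h
  have hr : 0 < ‖z‖ := norm_pos_iff.2 hz0
  have hlt : ‖z‖ < 1 / √(8 * (k : ℝ) + 8) := hz.trans_lt hη.1.1.2
  have hΔ : 0 ≤ (deltaPoly k).eval ‖z‖ := by
    rw [← hη.1.2]
    exact (strictAntiOn_deltaPoly hk).antitoneOn ⟨hr.le, hlt.le⟩
      ⟨hη.1.1.1.le, hη.1.1.2.le⟩ hz
  have h1 : ‖1 - z + 2 * (patternCount k : ℝ) * z ^ (2 * k + 1)‖ ^ 2 ≤
      8 * ‖z‖ ^ 2 * (k + 1 + (patternCount k * ‖z‖ ^ (2 * k)) ^ 2) := by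
    rw [aeval_deltaPoly, sub_eq_zero] at h
    rw [← norm_pow, Complex.ofReal_natCast, h, norm_mul, norm_mul, norm_pow, Complex.norm_ofNat]
    gcongr
    refine (norm_add_le _ _).trans ?_
    rw [norm_pow, norm_mul, norm_pow, Complex.norm_natCast]
    gcongr
    exact_mod_cast (Complex.norm_natCast (k + 1)).le
  have h2 := sq_norm_sub_sq (c := patternCount k) z (2 * k)
  have h3 := norm_pow_sub_re_pow_le z hz0 (2 * k)
  have h4 : 0 ≤ 4 * (patternCount k : ℝ) * ‖z‖ ^ 2 * (‖z‖ ^ (2 * k) - (z ^ (2 * k)).re) := by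
    have : (z ^ (2 * k)).re ≤ ‖z‖ ^ (2 * k) := by
      rw [← norm_pow]; exact Complex.re_le_norm _
    have := sub_nonneg.2 this
    positivity
  have h5 : 2 * (2 * k + 1) ^ 2 * ((patternCount k : ℝ) * ‖z‖ ^ (2 * k)) < 1 :=
    lt_of_le_of_lt (by gcongr) hb
  have h6 : 0 ≤ ‖z‖ - z.re := sub_nonneg.2 (Complex.re_le_norm z)
  have h7 : 4 * (patternCount k : ℝ) * (‖z‖ ^ (2 * k + 1) - (z ^ (2 * k + 1)).re) ≤
      4 * (patternCount k : ℝ) * ((2 * k + 1) ^ 2 * ‖z‖ ^ (2 * k) * (‖z‖ - z.re)) := by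
    push_cast at h3
    gcongr
  rw [eval_deltaPoly] at hΔ
  -- At a zero of Δ the gain is at most 0, because Δ(|z|) ≥ 0. By `h5` and `h7` it would be positive
  -- if Re z < |z|.
  have h8 : ‖z‖ - z.re = 0 := by
    by_contra hne
    have h9 := h6.lt_of_ne' hne
    nlinarith [mul_lt_mul_of_pos_right h5 h9]
  have h10 : z = (‖z‖ : ℂ) := by
    have him : z.im = 0 := Complex.abs_re_eq_norm.1
      (by rw [← sub_eq_zero.1 h8, abs_of_nonneg hr.le])
    exact Complex.ext (by simpa using (sub_eq_zero.1 h8).symm) (by simpa using him)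
  have h11 : (deltaPoly k).eval ‖z‖ = 0 := by
    rw [h10, ← Complex.coe_algebraMap, aeval_algebraMap_apply] at h
    simpa using h
  rw [h10, hη.2 _ ⟨hr, hlt⟩ h11]

/-! ### Absolutely convergent power series -/

/-- Absolute convergence of a power series on the closed disc of radius `r`. -/
def AbsConverges {K : Type*} [NormedField K] (r : ℝ) (f : PowerSeries K) : Prop :=
  Summable fun n => ‖PowerSeries.coeff n f‖ * r ^ n

section AbsConverges

variable {K : Type*} [NormedField K]

theorem AbsConverges.mono {r s : ℝ} (hr : 0 ≤ r) (hrs : r ≤ s) {f : PowerSeries K}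
    (hf : AbsConverges s f) : AbsConverges r f := by
  refine Summable.of_nonneg_of_le (fun n => by positivity) (fun n => ?_) hf
  gcongr

theorem AbsConverges.mul {r : ℝ} (hr : 0 ≤ r) {f g : PowerSeries K}
    (hf : AbsConverges r f) (hg : AbsConverges r g) : AbsConverges r (f * g) := by
  have h := summable_norm_sum_mul_antidiagonal_of_summable_norm
    (f := fun n => ‖PowerSeries.coeff n f‖ * r ^ n) (g := fun n => ‖PowerSeries.coeff n g‖ * r ^ n)
    (Summable.norm hf) (Summable.norm hg)
  refine Summable.of_nonneg_of_le (fun n => by positivity) (fun n => ?_) h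
  rw [PowerSeries.coeff_mul]
  refine (mul_le_mul_of_nonneg_right (norm_sum_le _ _) (by positivity)).trans ?_
  refine le_trans ?_ (Real.le_norm_self _)
  rw [Finset.sum_mul]
  refine Finset.sum_le_sum fun p hp => ?_
  rw [← Finset.HasAntidiagonal.mem_antidiagonal.1 hp, norm_mul, pow_add]
  exact (mul_mul_mul_comm _ _ _ _).le

theorem absConverges_coe (r : ℝ) (p : K[X]) : AbsConverges r (p : PowerSeries K) := by
  refine summable_of_ne_finset_zero (s := p.support) fun n hn => ?_
  rw [Polynomial.coeff_coe, Polynomial.notMem_support_iff.1 hn]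
  simp

theorem AbsConverges.summable {r : ℝ} {f : PowerSeries K} (hf : AbsConverges r f) {z : K}
    (hz : ‖z‖ ≤ r) : Summable fun n => ‖PowerSeries.coeff n f * z ^ n‖ := by
  refine Summable.of_nonneg_of_le (fun n => norm_nonneg _) (fun n => ?_) hf
  rw [norm_mul, norm_pow]
  gcongr

theorem absConverges_map {L : Type*} [NormedField L] (φ : K →+* L) (hφ : ∀ x, ‖φ x‖ = ‖x‖)
    {r : ℝ} {f : PowerSeries K} :
    AbsConverges r (f.map φ) ↔ AbsConverges r f := by
  simp only [AbsConverges, PowerSeries.coeff_map, hφ]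

theorem hasSum_coe (p : K[X]) (z : K) :
    HasSum (fun n => PowerSeries.coeff n (p : PowerSeries K) * z ^ n) (p.eval z) := by
  rw [Polynomial.eval_eq_sum]
  simp only [Polynomial.coeff_coe]
  exact hasSum_sum_of_ne_finset_zero fun n hn => by
    rw [Polynomial.notMem_support_iff.1 hn, zero_mul]

variable [CompleteSpace K]

theorem AbsConverges.hasSum_mul {r : ℝ} {f g : PowerSeries K} (hf : AbsConverges r f)
    (hg : AbsConverges r g) {z : K} (hz : ‖z‖ ≤ r) {a b : K}
    (ha : HasSum (fun n => PowerSeries.coeff n f * z ^ n) a)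
    (hb : HasSum (fun n => PowerSeries.coeff n g * z ^ n) b) :
    HasSum (fun n => PowerSeries.coeff n (f * g) * z ^ n) (a * b) := by
  have h1 := hf.summable hz
  have h2 := hg.summable hz
  have h3 := (summable_norm_sum_mul_antidiagonal_of_summable_norm h1 h2).of_norm
  have h4 := tsum_mul_tsum_eq_tsum_sum_antidiagonal_of_summable_norm h1 h2
  rw [ha.tsum_eq, hb.tsum_eq] at h4
  rw [h4]
  convert! h3.hasSum using 2 with n
  rw [PowerSeries.coeff_mul, Finset.sum_mul]
  refine Finset.sum_congr rfl fun p hp => ?_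
  rw [← Finset.HasAntidiagonal.mem_antidiagonal.1 hp, pow_add]
  ring

end AbsConverges

theorem AbsConverges.continuousOn {r : ℝ} {f : PowerSeries ℝ} (hf : AbsConverges r f) :
    ContinuousOn (fun z : ℝ => ∑' n, PowerSeries.coeff n f * z ^ n) (Set.Icc (-r) r) := by
  refine continuousOn_tsum (fun n => by fun_prop) hf fun n z hz => ?_
  rw [norm_mul, norm_pow]
  gcongr
  exact abs_le.2 hz

/-- A power series `f` with `f ^ 2 * q = 1` and `f(0) = 1` represents `1 / √q`. -/
theorem hasSum_inv_sqrt {f : PowerSeries ℝ} {q : ℝ[X]} (hfq : f ^ 2 * (q : PowerSeries ℝ) = 1)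
    (h0 : PowerSeries.constantCoeff f = 1) {r : ℝ} (hf : AbsConverges r f) {z : ℝ}
    (hz : |z| ≤ r) :
    0 < q.eval z ∧ HasSum (fun n => PowerSeries.coeff n f * z ^ n) (1 / √(q.eval z)) := by
  have hr : 0 ≤ r := (abs_nonneg z).trans hz
  let F : ℝ → ℝ := fun z => ∑' n, PowerSeries.coeff n f * z ^ n
  have hF {x : ℝ} (hx : |x| ≤ r) : HasSum (fun n => PowerSeries.coeff n f * x ^ n) (F x) :=
    (hf.summable hx).of_norm.hasSum
  have hsq {x : ℝ} (hx : |x| ≤ r) : F x ^ 2 * q.eval x = 1 := by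
    have h := AbsConverges.hasSum_mul (hf.mul hr hf) (absConverges_coe r q) hx
      (hf.hasSum_mul hf hx (hF hx) (hF hx)) (hasSum_coe q x)
    rw [← pow_two, hfq] at h
    have h1 := hasSum_coe (1 : ℝ[X]) x
    rw [Polynomial.coe_one, Polynomial.eval_one] at h1
    rw [pow_two]
    exact h.unique h1
  have hF0 : F 0 = 1 := by
    refine (hF (by simpa using hr)).unique ?_
    convert! hasSum_single (f := fun n => PowerSeries.coeff n f * (0 : ℝ) ^ n) 0 _ using 1
    · simp [h0]
    · intro n hn
      simp [hn]
  have hq : 0 < q.eval z := by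
    have := hsq hz
    by_contra hneg
    nlinarith [mul_nonneg (sq_nonneg (F z)) (neg_nonneg.2 (not_lt.1 hneg))]
  -- F is continuous with F(0) = 1 and cannot vanish, since F²q = 1; this selects the positive
  -- square root.
  have hpos : 0 < F z := by
    by_contra hneg
    have hz' := abs_le.1 hz
    obtain ⟨x, hx, hx0⟩ := isPreconnected_Icc.intermediate_value (a := z) (b := 0)
      ⟨hz'.1, hz'.2⟩ ⟨by linarith, hr⟩ hf.continuousOn
      (show (0 : ℝ) ∈ Set.Icc (F z) (F 0) from ⟨not_lt.1 hneg, by rw [hF0]; norm_num⟩)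
    have := hsq (abs_le.2 hx)
    rw [show F x = 0 from hx0] at this
    norm_num at this
  refine ⟨hq, ?_⟩
  have h1 : 1 / √(q.eval z) = F z := by
    rw [div_eq_iff (Real.sqrt_pos.2 hq).ne', ← Real.sqrt_sq hpos.le, ← Real.sqrt_mul (sq_nonneg _),
      hsq hz, Real.sqrt_one]
  rw [h1]
  exact hF hz

/-! ### Inverse square roots of polynomials -/

/-- The power series of `(1 - c z) ^ (-1/2)`. -/
noncomputable def invSqrt {K : Type*} [Field K] (c : K) : PowerSeries K :=
  .mk fun n => (n.centralBinom : K) / 4 ^ n * c ^ n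

theorem constantCoeff_invSqrt {K : Type*} [Field K] (c : K) :
    PowerSeries.constantCoeff (invSqrt c) = 1 := by
  rw [← PowerSeries.coeff_zero_eq_constantCoeff_apply, invSqrt, PowerSeries.coeff_mk]
  simp

/-- The central binomial recurrence says 2f'(1 - cz) = cf, so f²(1 - cz) has derivative zero and
constant term 1. -/
theorem invSqrt_sq_mul {K : Type*} [Field K] [CharZero K] (c : K) :
    invSqrt c ^ 2 * ((1 - C c * X : K[X]) : PowerSeries K) = 1 := by
  have hd : 2 * PowerSeries.derivative K (invSqrt c) * (1 - PowerSeries.C c * PowerSeries.X) =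
      PowerSeries.C c * invSqrt c := by
    have h : 2 * PowerSeries.derivative K (invSqrt c) * (1 - PowerSeries.C c * PowerSeries.X) =
        PowerSeries.C 2 * PowerSeries.derivative K (invSqrt c) -
        PowerSeries.C (2 * c) * (PowerSeries.X * PowerSeries.derivative K (invSqrt c)) := by
      rw [map_mul, map_ofNat]
      ring
    rw [h]
    ext n
    have hb : ((n : K) + 1) * (n + 1).centralBinom = 2 * (2 * n + 1) * n.centralBinom := by
      exact_mod_cast Nat.succ_mul_centralBinom_succ n
    rw [map_sub, PowerSeries.coeff_C_mul, PowerSeries.coeff_C_mul, PowerSeries.coeff_C_mul]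
    cases n with
    | zero =>
      rw [PowerSeries.coeff_zero_X_mul, PowerSeries.coeff_derivative]
      simp only [invSqrt, PowerSeries.coeff_mk]
      norm_num [Nat.centralBinom]
      ring
    | succ n =>
      rw [PowerSeries.coeff_succ_X_mul, PowerSeries.coeff_derivative, PowerSeries.coeff_derivative]
      simp only [invSqrt, PowerSeries.coeff_mk]
      push_cast at hb ⊢
      linear_combination (2 * c ^ (n + 2) / 4 ^ (n + 2)) * hb
  have hp : ((1 - C c * X : K[X]) : PowerSeries K) = 1 - PowerSeries.C c * PowerSeries.X := by
    simp
  rw [hp]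
  refine PowerSeries.derivative.ext ?_ ?_
  · rw [Derivation.leibniz, PowerSeries.derivative_pow, map_sub, Derivation.leibniz,
      PowerSeries.derivative_C, PowerSeries.derivative_X, PowerSeries.derivative_one]
    simp only [smul_eq_mul]
    linear_combination invSqrt c * hd
  · simp [constantCoeff_invSqrt]

theorem centralBinom_div_four_pow_le_one (n : ℕ) : (n.centralBinom : ℝ) / 4 ^ n ≤ 1 := by
  rw [div_le_one (by positivity)]
  exact_mod_cast Nat.centralBinom_le_four_pow n

theorem absConverges_invSqrt {K : Type*} [RCLike K] {c : K} {r : ℝ} (hr : 0 ≤ r)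
    (h : ‖c‖ * r < 1) : AbsConverges r (invSqrt c) := by
  refine Summable.of_nonneg_of_le (fun n => by positivity) (fun n => ?_)
    (summable_geometric_of_lt_one (by positivity) h)
  rw [invSqrt, PowerSeries.coeff_mk, norm_mul, norm_div, norm_pow, norm_pow, RCLike.norm_natCast,
    RCLike.norm_ofNat, mul_pow, mul_assoc]
  exact mul_le_of_le_one_left (by positivity) (centralBinom_div_four_pow_le_one n)

/-- If the polynomial `p` has no zero in a closed disc then `1 / √p` is analytic in a larger one. -/
theorem exists_invSqrt {r : ℝ} (hr : 0 ≤ r) (p : ℂ[X]) (h0 : p.coeff 0 = 1)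
    (hp : ∀ z, p.eval z = 0 → r < ‖z‖) :
    ∃ s > r, ∃ E : PowerSeries ℂ, E ^ 2 * (p : PowerSeries ℂ) = 1 ∧
      PowerSeries.constantCoeff E = 1 ∧ AbsConverges s E := by
  induction hn : p.natDegree generalizing p with
  | zero =>
    rw [Polynomial.eq_C_of_natDegree_eq_zero hn, h0]
    refine ⟨r + 1, by linarith, 1, by simp, by simp, ?_⟩
    simpa using absConverges_coe (r + 1) (1 : ℂ[X])
  | succ n ih =>
    have hp0 : p ≠ 0 := by rintro rfl; simp at h0
    obtain ⟨ρ, hρ⟩ := Complex.exists_root (f := p)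
      (Polynomial.natDegree_pos_iff_degree_pos.1 (by omega))
    have hρr := hp ρ hρ
    have hρ0 : ρ ≠ 0 := norm_pos_iff.1 (hr.trans_lt hρr)
    obtain ⟨q, rfl⟩ := Polynomial.dvd_iff_isRoot.2 hρ
    have hq0 : q ≠ 0 := right_ne_zero_of_mul hp0
    -- Each root is split off as 1 - z/ρ rather than z - ρ, so that the cofactor keeps constant term
    -- 1.
    have hfac : (X - C ρ) * q = (1 - C ρ⁻¹ * X) * (C (-ρ) * q) := by
      have : C ρ⁻¹ * C ρ = (1 : ℂ[X]) := by rw [← C_mul, inv_mul_cancel₀ hρ0, C_1]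
      rw [C_neg]
      linear_combination (-X * q) * this
    obtain ⟨s, hs, E, hE, hE0, hEs⟩ := ih (C (-ρ) * q)
      (by rw [hfac] at h0; simpa [Polynomial.mul_coeff_zero] using h0)
      (fun z hz => hp z (by
        rw [hfac, Polynomial.eval_mul, hz, mul_zero]))
      (by
        rw [Polynomial.natDegree_C_mul (neg_ne_zero.2 hρ0)]
        rw [Polynomial.natDegree_mul (Polynomial.X_sub_C_ne_zero ρ) hq0,
          Polynomial.natDegree_X_sub_C] at hn
        omega)
    have hmid : r < (r + ‖ρ‖) / 2 := by linarith
    refine ⟨min s ((r + ‖ρ‖) / 2), lt_min hs hmid, invSqrt ρ⁻¹ * E, ?_, ?_, ?_⟩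
    · rw [hfac, Polynomial.coe_mul]
      have := invSqrt_sq_mul ρ⁻¹
      linear_combination E ^ 2 * ((C (-ρ) * q : ℂ[X]) : PowerSeries ℂ) * this + hE
    · rw [map_mul, hE0, constantCoeff_invSqrt, mul_one]
    · have hm : 0 ≤ min s ((r + ‖ρ‖) / 2) := hr.trans (lt_min hs hmid).le
      refine AbsConverges.mul hm (absConverges_invSqrt hm ?_) (hEs.mono hm (min_le_left _ _))
      rw [norm_inv, inv_mul_lt_iff₀ (hr.trans_lt hρr), mul_one]
      exact (min_le_right _ _).trans_lt (by linarith)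

theorem eq_of_sq_mul_eq_one {K : Type*} [Field K] [CharZero K] {f g q : PowerSeries K}
    (hf : f ^ 2 * q = 1) (hg : g ^ 2 * q = 1) (hf0 : PowerSeries.constantCoeff f = 1)
    (hg0 : PowerSeries.constantCoeff g = 1) : f = g := by
  have hq : q ≠ 0 := right_ne_zero_of_mul (hf.trans_ne one_ne_zero)
  rcases sq_eq_sq_iff_eq_or_eq_neg.1 (mul_right_cancel₀ hq (hf.trans hg.symm)) with h | h
  · exact h
  · rw [h, map_neg, hg0] at hf0
    norm_num at hf0

/-! ### Asymptotics of coefficients -/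

/-- The coefficients of `(1 - z) ^ (-1/2)`. -/
noncomputable def invSqrtCoeff (n : ℕ) : ℝ := n.centralBinom / 4 ^ n

theorem invSqrtCoeff_pos (n : ℕ) : 0 < invSqrtCoeff n := by
  have := Nat.centralBinom_pos n
  rw [invSqrtCoeff]
  positivity

theorem invSqrtCoeff_succ (n : ℕ) :
    2 * (n + 1) * invSqrtCoeff (n + 1) = (2 * n + 1) * invSqrtCoeff n := by
  have hb : ((n : ℝ) + 1) * (n + 1).centralBinom = 2 * (2 * n + 1) * n.centralBinom := by
    exact_mod_cast Nat.succ_mul_centralBinom_succ n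
  rw [invSqrtCoeff, invSqrtCoeff, pow_succ]
  linear_combination (2 / (4 ^ n * 4)) * hb

theorem antitone_invSqrtCoeff : Antitone invSqrtCoeff := by
  refine antitone_nat_of_succ_le fun n => ?_
  have h1 := invSqrtCoeff_succ n
  have h2 := invSqrtCoeff_pos n
  have h3 : (0 : ℝ) < 2 * (n + 1) := by positivity
  refine le_of_mul_le_mul_left ?_ h3
  rw [h1]
  linarith

/-- Together with antitonicity this squeezes the ratio of the coefficients at n - j and n between 1
and (n+1)/(n-j+1), giving both its limit and the bound j + 1. -/
theorem monotone_mul_invSqrtCoeff : Monotone fun n : ℕ => ((n : ℝ) + 1) * invSqrtCoeff n := by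
  refine monotone_nat_of_le_succ fun n => ?_
  have h1 := invSqrtCoeff_succ n
  have h2 := invSqrtCoeff_pos n
  have h3 : (0 : ℝ) < n + 1 := by positivity
  push_cast
  refine le_of_mul_le_mul_left ?_ h3
  have h4 : ((n : ℝ) + 1) * ((n + 1 + 1) * invSqrtCoeff (n + 1)) =
      (n + 2) / 2 * ((2 * n + 1) * invSqrtCoeff n) := by
    rw [← h1]; ring
  rw [h4]
  nlinarith [mul_nonneg (Nat.cast_nonneg (α := ℝ) n) h2.le]

theorem tendsto_sqrt_mul_invSqrtCoeff :
    Filter.Tendsto (fun n : ℕ => √(n : ℝ) * invSqrtCoeff n) Filter.atTop (nhds (1 / √Real.pi)) := by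
  -- The Wallis partial product is the reciprocal of the squared coefficient, up to the factor 2n +
  -- 1.
  have hW (n : ℕ) : (Real.Wallis.W n)⁻¹ * (n / (2 * n + 1)) = n * invSqrtCoeff n ^ 2 := by
    have hc : (n.centralBinom : ℝ) = (2 * n).factorial / n.factorial ^ 2 := by
      rw [Nat.centralBinom_eq_two_mul_choose, Nat.cast_choose ℝ (by omega : n ≤ 2 * n), pow_two]
      congr 4
      omega
    have h4 : (2 : ℝ) ^ (4 * n) = (4 ^ n) ^ 2 := by
      rw [← pow_mul, show (4 : ℝ) = 2 ^ 2 by norm_num, ← pow_mul]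
      congr 1
      ring
    have := Nat.factorial_ne_zero n
    have := Nat.factorial_ne_zero (2 * n)
    rw [Real.Wallis.W_eq_factorial_ratio, invSqrtCoeff, hc, h4]
    field_simp
  have hlim : Filter.Tendsto (fun n : ℕ => (n : ℝ) / (2 * n + 1)) Filter.atTop (nhds (1 / 2)) := by
    have h := (tendsto_natCast_div_add_atTop (1 / 2 : ℝ)).const_mul (1 / 2)
    rw [mul_one] at h
    refine h.congr fun n => ?_
    field_simp
  have h := ((Real.Wallis.tendsto_W_nhds_pi_div_two.inv₀ (by positivity)).mul hlim).sqrt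
  have he : √((Real.pi / 2)⁻¹ * (1 / 2)) = 1 / √Real.pi := by
    rw [show (Real.pi / 2)⁻¹ * (1 / 2) = 1 / Real.pi by field_simp, Real.sqrt_div zero_le_one,
      Real.sqrt_one]
  rw [he] at h
  refine h.congr fun n => ?_
  rw [hW, Real.sqrt_mul (Nat.cast_nonneg n), Real.sqrt_sq (invSqrtCoeff_pos n).le]

theorem tendsto_invSqrtCoeff_sub_div (j : ℕ) :
    Filter.Tendsto (fun n => invSqrtCoeff (n - j) / invSqrtCoeff n) Filter.atTop (nhds 1) := by
  rw [← Filter.tendsto_add_atTop_iff_nat j]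
  simp only [Nat.add_sub_cancel]
  have hlim : Filter.Tendsto (fun n : ℕ => 1 + (j : ℝ) / (n + 1)) Filter.atTop (nhds 1) := by
    have h := (tendsto_one_div_add_atTop_nhds_zero_nat (𝕜 := ℝ)).const_mul (j : ℝ)
    simpa [div_eq_mul_inv] using h.const_add 1
  refine tendsto_of_tendsto_of_tendsto_of_le_of_le tendsto_const_nhds hlim
    (fun n => ?_) (fun n => ?_)
  · exact (one_le_div (invSqrtCoeff_pos _)).2 (antitone_invSqrtCoeff (Nat.le_add_right n j))
  · have h := monotone_mul_invSqrtCoeff (Nat.le_add_right n j)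
    have h1 : (0 : ℝ) < n + 1 := by positivity
    have h2 : 1 + (j : ℝ) / (n + 1) = (n + j + 1) / (n + 1) := by field_simp; ring
    simp only [Nat.cast_add] at h
    rw [h2, div_le_div_iff₀ (invSqrtCoeff_pos _) h1]
    linarith

theorem invSqrtCoeff_sub_div_le {n j : ℕ} (h : j ≤ n) :
    invSqrtCoeff (n - j) / invSqrtCoeff n ≤ j + 1 := by
  obtain ⟨m, rfl⟩ := Nat.exists_eq_add_of_le' h
  rw [Nat.add_sub_cancel, div_le_iff₀ (invSqrtCoeff_pos _)]
  have h := monotone_mul_invSqrtCoeff (Nat.le_add_right m j)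
  simp only [Nat.cast_add] at h
  have h1 : (0 : ℝ) < m + 1 := by positivity
  refine le_of_mul_le_mul_left (h.trans ?_) h1
  have := invSqrtCoeff_pos (m + j)
  rw [← mul_assoc]
  gcongr
  nlinarith [mul_nonneg (Nat.cast_nonneg (α := ℝ) m) (Nat.cast_nonneg (α := ℝ) j)]

/-- By Bernoulli's inequality (s/r)^n outgrows a positive multiple of n + 1. This supplies the
dominating series for the transfer. -/
theorem AbsConverges.summable_succ_mul {r s : ℝ} (hr : 0 < r) (hrs : r < s) {f : PowerSeries ℝ}
    (hf : AbsConverges s f) :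
    Summable fun n : ℕ => ((n : ℝ) + 1) * (‖PowerSeries.coeff n f‖ * r ^ n) := by
  have hδ : 0 < min 1 (s / r - 1) := lt_min one_pos (by rw [sub_pos, one_lt_div hr]; exact hrs)
  refine Summable.of_nonneg_of_le (fun n => by positivity) (fun n => ?_)
    (hf.mul_left (min 1 (s / r - 1))⁻¹)
  rw [le_inv_mul_iff₀ hδ]
  have h1 := one_add_mul_le_pow (a := s / r - 1) (by linarith [min_le_right 1 (s / r - 1)]) n
  have h2 : min 1 (s / r - 1) * (n + 1) ≤ 1 + n * (s / r - 1) := by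
    have := mul_le_mul_of_nonneg_left (min_le_right 1 (s / r - 1)) (Nat.cast_nonneg (α := ℝ) n)
    linarith [min_le_left 1 (s / r - 1)]
  have h3 : min 1 (s / r - 1) * (n + 1) * r ^ n ≤ s ^ n := by
    rw [← le_div_iff₀ (by positivity), ← div_pow]
    refine h2.trans (h1.trans_eq ?_)
    congr 1
    ring
  calc min 1 (s / r - 1) * ((n + 1) * (‖PowerSeries.coeff n f‖ * r ^ n))
      = ‖PowerSeries.coeff n f‖ * (min 1 (s / r - 1) * (n + 1) * r ^ n) := by ring
    _ ≤ ‖PowerSeries.coeff n f‖ * s ^ n := by gcongr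

/-- Transfer: the coefficients of `(1 - z / η) ^ (-1/2) * f`, for `f` analytic beyond `η`. -/
theorem tendsto_coeff_invSqrt_mul {η s : ℝ} (hη : 0 < η) (hs : η < s) {f : PowerSeries ℝ}
    (hf : AbsConverges s f) {a : ℝ} (ha : HasSum (fun n => PowerSeries.coeff n f * η ^ n) a) :
    Filter.Tendsto
      (fun n => PowerSeries.coeff n (invSqrt (1 / η) * f) * η ^ n / invSqrtCoeff n)
      Filter.atTop (nhds a) := by
  -- The normalised Cauchy product, extended by zero to j > n. Each term tends to f_j η^j and is
  -- bounded by (j+1)|f_j|η^j.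
  let F : ℕ → ℕ → ℝ := fun n j =>
    if j ≤ n then invSqrtCoeff (n - j) / invSqrtCoeff n * (PowerSeries.coeff j f * η ^ j) else 0
  have hF (n : ℕ) : PowerSeries.coeff n (invSqrt (1 / η) * f) * η ^ n / invSqrtCoeff n =
      ∑' j, F n j := by
    rw [tsum_eq_sum (s := Finset.range (n + 1))
      (fun j hj => if_neg (by simpa [Nat.lt_succ_iff] using hj)), mul_comm (invSqrt _),
      PowerSeries.coeff_mul, Finset.Nat.sum_antidiagonal_eq_sum_range_succ_mk, Finset.sum_mul,
      Finset.sum_div]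
    refine Finset.sum_congr rfl fun j hj => ?_
    have hj' : j ≤ n := Nat.lt_succ_iff.1 (Finset.mem_range.1 hj)
    simp only [if_pos hj', invSqrt, PowerSeries.coeff_mk, invSqrtCoeff]
    have : η ^ n = η ^ (n - j) * η ^ j := by rw [← pow_add, Nat.sub_add_cancel hj']
    rw [this, one_div, inv_pow]
    field_simp
  simp only [hF]
  rw [← ha.tsum_eq]
  refine tendsto_tsum_of_dominated_convergence (hf.summable_succ_mul hη hs) (fun j => ?_)
    (Filter.Eventually.of_forall fun n j => ?_)
  · have h := (tendsto_invSqrtCoeff_sub_div j).mul_const (PowerSeries.coeff j f * η ^ j)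
    rw [one_mul] at h
    refine h.congr' ?_
    filter_upwards [Filter.eventually_ge_atTop j] with n hn
    simp only [F, if_pos hn]
  · simp only [F]
    split_ifs with hj
    · have h1 := invSqrtCoeff_sub_div_le hj
      have h2 := (div_pos (invSqrtCoeff_pos (n - j)) (invSqrtCoeff_pos n)).le
      rw [norm_mul, norm_mul, Real.norm_of_nonneg h2, norm_pow, Real.norm_of_nonneg hη.le]
      gcongr
    · rw [norm_zero]
      positivity

/-! ### The main theorem -/

/-- Here C_k x^{2k-1} ≤ 1 and the bracket multiplying it is at most 1, so g ≥ 1. -/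
theorem eval_gPoly_pos {k : ℕ} (hk : 1 ≤ k) {x : ℝ} (hx0 : 0 ≤ x)
    (hx : 8 * (k + 1) * x ^ 2 ≤ 1) : 0 < (gPoly k).eval x := by
  have h1 : (patternCount k : ℝ) * x ^ (2 * k - 1) ≤ 1 := by
    obtain ⟨n, rfl⟩ := Nat.exists_eq_add_of_le' hk
    have h2 : (patternCount (n + 1) : ℝ) ≤ (8 * (n + 2)) ^ n := by
      rw [patternCount_succ]
      have : n.factorial * n.centralBinom ≤ (8 * (n + 2)) ^ n := by
        calc n.factorial * n.centralBinom ≤ n ^ n * 4 ^ n :=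
              Nat.mul_le_mul (Nat.factorial_le_pow n) (Nat.centralBinom_le_four_pow n)
          _ = (n * 4) ^ n := (mul_pow _ _ _).symm
          _ ≤ (8 * (n + 2)) ^ n := Nat.pow_le_pow_left (by omega) n
      exact_mod_cast this
    have h3 : 2 * (n + 1) - 1 = 2 * n + 1 := by omega
    push_cast at hx
    have hx1 : x ≤ 1 := by nlinarith [mul_nonneg (Nat.cast_nonneg (α := ℝ) n) (sq_nonneg x)]
    rw [h3, pow_succ, pow_mul, ← mul_assoc]
    refine mul_le_one₀ ?_ hx0 hx1
    calc (patternCount (n + 1) : ℝ) * (x ^ 2) ^ n ≤ (8 * (n + 2)) ^ n * (x ^ 2) ^ n := by gcongr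
      _ = (8 * (n + 2) * x ^ 2) ^ n := (mul_pow _ _ _).symm
      _ ≤ 1 := pow_le_one₀ (by positivity) (by linarith)
  have h0 : 0 ≤ (patternCount k : ℝ) * x ^ (2 * k - 1) := by positivity
  have h4 : 0 ≤ (patternCount k : ℝ) * x ^ (2 * k + 1) := by positivity
  simp only [gPoly, hPoly, eval_sub, eval_mul, eval_pow, eval_X, eval_C, eval_one, eval_ofNat]
  nlinarith [mul_nonneg h0 h4, mul_nonneg h0 hx0]

theorem exists_factor {k : ℕ} {η : ℝ} (hη : IsEta k η) :
    ∃ ψ : ℝ[X], deltaPoly k = (1 - C (1 / η) * X) * ψ := by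
  obtain ⟨q, hq⟩ := Polynomial.dvd_iff_isRoot.2 hη.1.2
  have hη0 : η ≠ 0 := hη.1.1.1.ne'
  refine ⟨C (-η) * q, ?_⟩
  have : C (1 / η) * C η = (1 : ℝ[X]) := by rw [← C_mul, one_div, inv_mul_cancel₀ hη0, C_1]
  rw [hq, C_neg]
  linear_combination (-X * q) * this

/-- A zero of ψ in the closed disc is a zero of Δ, hence equals η; then η would be a double zero,
against Δ'(η) < 0. -/
theorem lt_norm_of_factor {k : ℕ} (hk : 1 ≤ k) {η : ℝ} (hη : IsEta k η)
    (hb : 2 * (2 * k + 1) ^ 2 * ((patternCount k : ℝ) * η ^ (2 * k)) < 1) {ψ : ℝ[X]}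
    (hψ : deltaPoly k = (1 - C (1 / η) * X) * ψ) (z : ℂ)
    (hz : (ψ.map (algebraMap ℝ ℂ)).eval z = 0) : η < ‖z‖ := by
  by_contra hle
  rw [Polynomial.eval_map_algebraMap] at hz
  have h1 : aeval z (deltaPoly k) = 0 := by rw [hψ, map_mul, hz, mul_zero]
  have h2 := eq_of_aeval_deltaPoly_eq_zero hk hη hb (not_lt.1 hle) h1
  rw [h2, ← Complex.coe_algebraMap, aeval_algebraMap_apply] at hz
  have h3 : ψ.eval η = 0 := by simpa using hz
  have h4 := eval_derivative_deltaPoly_neg hk hη.1.1.1.le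
    ((mul_sq_le_one_iff k hη.1.1.1.le).2 hη.1.1.2.le)
  have hη0 : η ≠ 0 := hη.1.1.1.ne'
  rw [hψ] at h4
  simp [derivative_mul, h3, hη0] at h4

/-- The inverse square root of ψ is built over ℂ, where ψ splits. Uniqueness given constant term 1
identifies it with a real series, which inherits the larger radius. -/
theorem exists_regular_factor {k : ℕ} (hk : 1 ≤ k) {η : ℝ} (hη : IsEta k η)
    (hb : 2 * (2 * k + 1) ^ 2 * ((patternCount k : ℝ) * η ^ (2 * k)) < 1) {ψ : ℝ[X]}
    (hψ : deltaPoly k = (1 - C (1 / η) * X) * ψ) :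
    ∃ s > η, ∃ E : PowerSeries ℝ, E ^ 2 * (ψ : PowerSeries ℝ) = 1 ∧
      PowerSeries.constantCoeff E = 1 ∧ AbsConverges s E ∧
      (sqrtDelta k)⁻¹ = invSqrt (1 / η) * E := by
  have hψ0 : ψ.coeff 0 = 1 := by
    have h : (deltaPoly k).eval 0 = 1 := by rw [eval_deltaPoly]; simp
    rw [hψ] at h
    simpa [Polynomial.coeff_zero_eq_eval_zero] using h
  obtain ⟨s, hs, Ec, hEc, hEc0, hEcs⟩ := exists_invSqrt hη.1.1.1.le (ψ.map (algebraMap ℝ ℂ))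
    (by rw [Polynomial.coeff_map, hψ0, map_one]) (lt_norm_of_factor hk hη hb hψ)
  -- The square root of 1 - z/η is written as its inverse square root times 1 - z/η.
  let E : PowerSeries ℝ := (sqrtDelta k)⁻¹ * invSqrt (1 / η) *
    ((1 - C (1 / η) * X : ℝ[X]) : PowerSeries ℝ)
  have hI := invSqrt_sq_mul (1 / η)
  have hS : sqrtDelta k * (sqrtDelta k)⁻¹ = 1 :=
    PowerSeries.mul_inv_cancel _ (by simp [constantCoeff_sqrtDelta])
  have hS2 := sqrtDelta_sq hk
  rw [hψ, Polynomial.coe_mul] at hS2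
  have hE : E ^ 2 * (ψ : PowerSeries ℝ) = 1 := by
    simp only [E]
    generalize ((1 - C (1 / η) * X : ℝ[X]) : PowerSeries ℝ) = q at *
    linear_combination ((sqrtDelta k)⁻¹ ^ 2 * q * ψ) * hI - (sqrtDelta k)⁻¹ ^ 2 * hS2 +
      (sqrtDelta k * (sqrtDelta k)⁻¹ + 1) * hS
  have hE0 : PowerSeries.constantCoeff E = 1 := by
    simp [E, constantCoeff_invSqrt, constantCoeff_sqrtDelta]
  have hmap : E.map (algebraMap ℝ ℂ) = Ec := by
    refine eq_of_sq_mul_eq_one ?_ hEc ?_ hEc0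
    · rw [Polynomial.polynomial_map_coe, ← map_pow, ← map_mul, hE, map_one]
    · rw [← PowerSeries.coeff_zero_eq_constantCoeff_apply, PowerSeries.coeff_map,
        PowerSeries.coeff_zero_eq_constantCoeff_apply, hE0, map_one]
  refine ⟨s, hs, E, hE, hE0, ?_, ?_⟩
  · rw [← hmap, absConverges_map _ (fun x => by simp)] at hEcs
    exact hEcs
  · simp only [E]
    linear_combination (-(sqrtDelta k)⁻¹) * hI

theorem letterSeries_eq_add {k : ℕ} (hk : 1 ≤ k) :
    letterSeries k = ((C ((k : ℝ) / 2 * patternCount k) * X ^ (2 * k) : ℝ[X]) : PowerSeries ℝ) +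
      ((C ((k : ℝ) / 2) * X * gPoly k : ℝ[X]) : PowerSeries ℝ) * (sqrtDelta k)⁻¹ := by
  have h := two_mul_letterSeries hk
  have h2 : PowerSeries.C (1 / 2 : ℝ) * 2 = 1 := by
    rw [← map_ofNat (PowerSeries.C (R := ℝ)) 2, ← map_mul]
    norm_num
  have hk2 : PowerSeries.C ((k : ℝ) / 2) = PowerSeries.C (1 / 2 : ℝ) * (k : PowerSeries ℝ) := by
    rw [← map_natCast (PowerSeries.C (R := ℝ)) k, ← map_mul]
    congr 1
    ring
  simp only [Polynomial.coe_mul, Polynomial.coe_pow, Polynomial.coe_X, Polynomial.coe_C, map_mul,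
    hk2]
  rw [patternSeries] at h
  linear_combination PowerSeries.C (1 / 2 : ℝ) * h - letterSeries k * h2

end RENoSigmaStar

open RENoSigmaStar in
theorem mainTheorem5 (k : ℕ) (hk : 1 ≤ k) :
    ∃ (η : ℝ) (ψ : Polynomial ℝ),
      RENoSigmaStar.IsEta k η ∧
      RENoSigmaStar.deltaPoly k = (1 - Polynomial.C (1 / η) * Polynomial.X) * ψ ∧
      0 < ψ.eval η ∧
      (∀ z : ℝ, |z| < η →
        0 < (RENoSigmaStar.deltaPoly k).eval z ∧
        HasSum (fun n : ℕ => (RENoSigmaStar.totalLetters k n : ℝ) * z ^ n)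
          ((k : ℝ) * z ^ (2 * k) * (RENoSigmaStar.patternCount k : ℝ) / 2 +
            (k : ℝ) * z * (RENoSigmaStar.gPoly k).eval z /
              (2 * √((RENoSigmaStar.deltaPoly k).eval z)))) ∧
      Asymptotics.IsEquivalent Filter.atTop
        (fun n : ℕ => (RENoSigmaStar.totalLetters k n : ℝ))
        (fun n : ℕ =>
          (k : ℝ) * η * (RENoSigmaStar.gPoly k).eval η / (2 * √Real.pi * √(ψ.eval η)) *
            (n : ℝ) ^ (-(1 / 2) : ℝ) * η ^ (-(n : ℤ))) := by
  obtain ⟨η, hη, hb⟩ := exists_isEta hk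
  obtain ⟨ψ, hψ⟩ := exists_factor hη
  obtain ⟨s, hs, E, hE, hE0, hEs, hSE⟩ := exists_regular_factor hk hη hb hψ
  have hη0 : 0 < η := hη.1.1.1
  have hs0 : 0 ≤ s := (hη0.trans hs).le
  have hηs : |η| ≤ s := by rw [abs_of_pos hη0]; exact hs.le
  obtain ⟨hψη, hEη⟩ := hasSum_inv_sqrt hE hE0 hEs hηs
  have hL := letterSeries_eq_add hk
  set p₁ : ℝ[X] := C ((k : ℝ) / 2 * patternCount k) * X ^ (2 * k) with hp₁
  set p₂ : ℝ[X] := C ((k : ℝ) / 2) * X * gPoly k with hp₂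
  have hcoeff (n : ℕ) : PowerSeries.coeff n (letterSeries k) = totalLetters k n := by
    rw [letterSeries, PowerSeries.coeff_mk]
  refine ⟨η, ψ, hη, hψ, hψη, fun z hz => ?_, ?_⟩
  · have hD : AbsConverges |z| (sqrtDelta k)⁻¹ := by
      rw [hSE]
      refine AbsConverges.mul (abs_nonneg z) (absConverges_invSqrt (abs_nonneg z) ?_)
        (hEs.mono (abs_nonneg z) (hz.le.trans hs.le))
      rw [norm_div, norm_one, Real.norm_of_nonneg hη0.le, one_div_mul_eq_div, div_lt_one hη0]
      exact hz
    have hS0 : PowerSeries.constantCoeff (sqrtDelta k) ≠ 0 := by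
      rw [constantCoeff_sqrtDelta]; exact one_ne_zero
    have hDΔ : (sqrtDelta k)⁻¹ ^ 2 * (deltaPoly k : PowerSeries ℝ) = 1 := by
      rw [← sqrtDelta_sq hk, ← mul_pow, PowerSeries.inv_mul_cancel _ hS0, one_pow]
    obtain ⟨hΔ, hsum⟩ := hasSum_inv_sqrt hDΔ
      (by rw [PowerSeries.constantCoeff_inv, constantCoeff_sqrtDelta, inv_one]) hD le_rfl
    refine ⟨hΔ, ?_⟩
    have h := (hasSum_coe p₁ z).add
      ((absConverges_coe |z| p₂).hasSum_mul hD le_rfl (hasSum_coe p₂ z) hsum)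
    convert! h using 1
    · funext n
      rw [← hcoeff, hL, map_add, add_mul]
    · simp only [hp₁, hp₂, eval_mul, eval_C, eval_X, eval_pow]
      have := (Real.sqrt_pos.2 hΔ).ne'
      field_simp
  · have hp₂E := (absConverges_coe s p₂).hasSum_mul hEs hηs (hasSum_coe p₂ η) hEη
    have hlim := (tendsto_coeff_invSqrt_mul hη0 hs ((absConverges_coe s p₂).mul hs0 hEs)
      hp₂E).mul tendsto_sqrt_mul_invSqrtCoeff
    have hg := eval_gPoly_pos hk hη0.le ((mul_sq_le_one_iff k hη0.le).2 hη.1.1.2.le)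
    have hk0 : (0 : ℝ) < k := by exact_mod_cast hk
    have hψs := Real.sqrt_pos.2 hψη
    have hπ := Real.sqrt_pos.2 Real.pi_pos
    have hK : 0 < (k : ℝ) * η * (gPoly k).eval η / (2 * √Real.pi * √(ψ.eval η)) := by positivity
    have hval : p₂.eval η * (1 / √(ψ.eval η)) * (1 / √Real.pi) =
        (k : ℝ) * η * (gPoly k).eval η / (2 * √Real.pi * √(ψ.eval η)) := by
      simp only [hp₂, eval_mul, eval_C, eval_X]
      field_simp
    rw [hval] at hlim
    refine Asymptotics.isEquivalent_of_tendsto_one ?_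
    have hone := hlim.div_const ((k : ℝ) * η * (gPoly k).eval η / (2 * √Real.pi * √(ψ.eval η)))
    rw [div_self hK.ne'] at hone
    refine hone.congr' ?_
    -- Beyond degree 2k the polynomial summand of L no longer contributes.
    filter_upwards [Filter.eventually_gt_atTop (2 * k)] with n hn
    have hn0 : (0 : ℝ) < n := by exact_mod_cast (Nat.zero_le _).trans_lt hn
    have hc : PowerSeries.coeff n (invSqrt (1 / η) * ((p₂ : PowerSeries ℝ) * E)) =
        totalLetters k n := by
      rw [← hcoeff, hL, hSE, map_add, Polynomial.coeff_coe, hp₁, Polynomial.coeff_C_mul_X_pow,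
        if_neg hn.ne', zero_add]
      congr 1
      ring
    have hpow : (n : ℝ) ^ (-(1 / 2) : ℝ) = (√(n : ℝ))⁻¹ := by
      rw [Real.rpow_neg hn0.le, Real.sqrt_eq_rpow]
    have hb0 := (invSqrtCoeff_pos n).ne'
    have hsn := (Real.sqrt_pos.2 hn0).ne'
    rw [hc, Pi.div_apply, hpow, zpow_neg, zpow_natCast]
    field_simp
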